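/- **Theorem 2.** Let $\{\xi(t):t\ge 0\}$, $\xi(0)=0$, be a real-valued Lévy process on a probability space (independent and stationary increments, right-continuous paths with left limits), and let $B>0$, $s>0$. For $x\ge 0$ put $$\tau^x=\inf\{t:\xi(t)>x\},\quad T^x=\xi(\tau^x)-x,\qquad \tau_x=\inf\{t:\xi(t)<-x\},\quad T_x=-\xi(\tau_x)-x .$$ For $y\in[0,B]$ let $\chi(y)=\inf\{t: y+\xi(t)\notin[0,B]\}$, let $A^B=\{\chi(y)<\infty,\ y+\xi(\chi(y))\ge B\}$ and $A_0=\{\chi(y)<\infty,\ y+\xi(\chi(y))\le 0\}$ be the events of exit through the upper and the lower boundary, and let $X(y)=y+\xi(\chi(y))-B$ on $A^B$, $X(y)=-(y+\xi(\chi(y)))$ on $A_0$; for $y\notin[0,B]$ put $\chi(y)=0$. For $y\in\mathbb R$ let $$\overline\chi(y)=\inf\{t>\chi(y): y+\xi(t)\in[0,B]\},\qquad \overline X(y)=y+\xi(\overline\chi(y)).$$ Here $\inf\emptyset=\infty$ and $e^{-s\cdot\infty}=0$; an expression $E[e^{-s\tau};Y\in du,A]$ denotes the measure $D\mapsto E[e^{-s\tau}\mathbf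 1_{\{Y\in D\}\cap A}]$. Define $$Q_+(v,du,s)=\int_{(0,\infty)}E[e^{-s\tau_v};T_v-B\in dl]\,E[e^{-s\tau^l};T^l-B\in du],$$ $$Q_-(v,du,s)=\int_{(0,\infty)}E[e^{-s\tau^v};T^v-B\in dl]\,E[e^{-s\tau_l};T_l-B\in du],\qquad u>0,$$ $Q_\pm^{(1)}=Q_\pm$, $Q_\pm^{(n+1)}(v,du,s)=\int_{(0,\infty)}Q_\pm^{(n)}(v,dl,s)\,Q_\pm(l,du,s)$, and $$Q_\pm^s(v,du)=\delta_v(du)+\sum_{n\ge1}Q_\pm^{(n)}(v,du,s).$$ Then $\overline X(y)\in[0,B]$ whenever $\overline\chi(y)<\infty$; the measures $Q^s_\pm(v,\cdot)$ are finite for every $v\ge0$; and, with $b(y,du,s)=E[e^{-s\overline\chi(y)};\overline X(y)\in du]$ for $y\in\mathbb R$, and $b^v(du,s)=b(v+B,du,s)$, $b_v(du,s)=b(-v,du,s)$ for $v\ge0$, the following equalities of measures on $[0,B]$ hold. 1. For every $v>0$ such that, for Lebesgue-almost every $t\ge 0$, $P[v+B+\xi(t)\in\{0,B\}]=0$, $$b^v(du,s)=\int_{[0,\infty)}Q_+^s(v,dl)\,E[e^{-s\tau_l};B-T_l\in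 du]+\int_{[0,\infty)}Q_+^s(v,dl)\int_{(0,\infty)}E[e^{-s\tau_l};T_l-B\in d\nu]\,E[e^{-s\tau^\nu};T^\nu\in du].$$ 2. For every $v>0$ such that, for Lebesgue-almost every $t\ge 0$, $P[-v+\xi(t)\in\{0,B\}]=0$, $$b_v(du,s)=\int_{[0,\infty)}Q_-^s(v,dl)\,E[e^{-s\tau^l};T^l\in du]+\int_{[0,\infty)}Q_-^s(v,dl)\int_{(0,\infty)}E[e^{-s\tau^l};T^l-B\in d\nu]\,E[e^{-s\tau_\nu};B-T_\nu\in du].$$ The equality in 1 (in 2) holds under the same condition also for $v=0$ if $\chi(B)=0$ almost surely (if $\chi(0)=0$ almost surely). 3. For every $y\in[0,B]$, $$b(y,du,s)=\int_{[0,\infty)}E[e^{-s\chi(y)};X(y)\in dv,A^B]\,b^v(du,s)+\int_{[0,\infty)}E[e^{-s\chi(y)};X(y)\in dv,A_0]\,b_v(du,s).$$ The conditions on $v$ in 1 and 2 hold for every $v>0$ unless $\xi$ is a compound Poisson process whose jump distribution has atoms; in that case they hold for all but countably many $v>0$. -/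

import Mathlib

open MeasureTheory ProbabilityTheory Topology
open scoped NNReal ENNReal

noncomputable section

namespace LevyEntry

/-- A real-valued Lévy process started at `0`: independent and stationary increments,
right-continuous paths with left limits. -/
structure IsLevyProcess {Ω : Type*} [MeasurableSpace Ω] (P : Measure Ω)
    (ξ : ℝ≥0 → Ω → ℝ) : Prop where
  measurable : ∀ t, Measurable (ξ t)
  zero : ∀ ω, ξ 0 ω = 0
  indep : HasIndepIncrements ξ P
  stationary : ∀ r t : ℝ≥0, IdentDistrib (fun ω => ξ (r + t) ω - ξ r ω) (ξ t) P P
  rightCont : ∀ ω t, ContinuousWithinAt (fun r => ξ r ω) (Set.Ici t) t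
  leftLim : ∀ ω t, ∃ l : ℝ, Filter.Tendsto (fun r => ξ r ω) (𝓝[<] t) (𝓝 l)

/-- The infimum of a set of times, equal to `∞` when the set is empty. -/
def firstTime (S : Set ℝ≥0) : ℝ≥0∞ := ⨅ t ∈ S, (t : ℝ≥0∞)

variable {Ω : Type*}

/-- `τ^x = inf {t : ξ(t) > x}`. -/
def tauUp (ξ : ℝ≥0 → Ω → ℝ) (x : ℝ) (ω : Ω) : ℝ≥0∞ := firstTime {t | x < ξ t ω}

/-- `τ_x = inf {t : ξ(t) < -x}`. -/
def tauDown (ξ : ℝ≥0 → Ω → ℝ) (x : ℝ) (ω : Ω) : ℝ≥0∞ := firstTime {t | ξ t ω < -x}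

/-- `T^x = ξ(τ^x) - x` (only used where `τ^x < ∞`). -/
def overshootUp (ξ : ℝ≥0 → Ω → ℝ) (x : ℝ) (ω : Ω) : ℝ :=
  ξ (tauUp ξ x ω).toNNReal ω - x

/-- `T_x = -ξ(τ_x) - x` (only used where `τ_x < ∞`). -/
def overshootDown (ξ : ℝ≥0 → Ω → ℝ) (x : ℝ) (ω : Ω) : ℝ :=
  -ξ (tauDown ξ x ω).toNNReal ω - x

/-- `χ(y)`: the first exit time of `y + ξ` from `[0,B]` if `y ∈ [0,B]`, and `0` otherwise. -/
def exitTime (ξ : ℝ≥0 → Ω → ℝ) (B y : ℝ) (ω : Ω) : ℝ≥0∞ :=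
  if y ∈ Set.Icc 0 B then firstTime {t | y + ξ t ω ∉ Set.Icc 0 B} else 0

/-- The position `y + ξ(χ(y))` at the first exit (only used where `χ(y) < ∞`). -/
def exitPos (ξ : ℝ≥0 → Ω → ℝ) (B y : ℝ) (ω : Ω) : ℝ :=
  y + ξ (exitTime ξ B y ω).toNNReal ω

/-- Exit through the upper boundary. A continuous exit, at which the position is exactly `B`,
is included. -/
def exitAbove (ξ : ℝ≥0 → Ω → ℝ) (B y : ℝ) : Set Ω := {ω | B ≤ exitPos ξ B y ω}

/-- Exit through the lower boundary, including a continuous exit at which the position is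
exactly `0`. -/
def exitBelow (ξ : ℝ≥0 → Ω → ℝ) (B y : ℝ) : Set Ω := {ω | exitPos ξ B y ω ≤ 0}

/-- `χ̄(y) = inf {t > χ(y) : y + ξ(t) ∈ [0,B]}`. -/
def entryTime (ξ : ℝ≥0 → Ω → ℝ) (B y : ℝ) (ω : Ω) : ℝ≥0∞ :=
  firstTime {t | exitTime ξ B y ω < (t : ℝ≥0∞) ∧ y + ξ t ω ∈ Set.Icc 0 B}

/-- `X̄(y) = y + ξ(χ̄(y))` (only used where `χ̄(y) < ∞`). -/
def entryPos (ξ : ℝ≥0 → Ω → ℝ) (B y : ℝ) (ω : Ω) : ℝ :=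
  y + ξ (entryTime ξ B y ω).toNNReal ω

/-- `e^{-sτ}`, equal to `0` where `τ = ∞`. -/
def discount (s : ℝ) (τ : Ω → ℝ≥0∞) (ω : Ω) : ℝ≥0∞ :=
  if τ ω = ∞ then 0 else ENNReal.ofReal (Real.exp (-(s * (τ ω).toReal)))

variable [MeasurableSpace Ω]

/-- The measure `E[e^{-sτ}; Y ∈ du, A]` on the line. -/
def transform (P : Measure Ω) (s : ℝ) (τ : Ω → ℝ≥0∞) (Y : Ω → ℝ) (A : Set Ω) : Measure ℝ :=
  ((P.withDensity (discount s τ)).restrict A).map Y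

/-- `E[e^{-sτ^x}; T^x ∈ du]`. -/
def upLaw (P : Measure Ω) (ξ : ℝ≥0 → Ω → ℝ) (s x : ℝ) : Measure ℝ :=
  transform P s (tauUp ξ x) (overshootUp ξ x) Set.univ

/-- `E[e^{-sτ_x}; T_x ∈ du]`. -/
def downLaw (P : Measure Ω) (ξ : ℝ≥0 → Ω → ℝ) (s x : ℝ) : Measure ℝ :=
  transform P s (tauDown ξ x) (overshootDown ξ x) Set.univ

/-- `E[e^{-sτ^x}; T^x - B ∈ du]`, `u > 0`. -/
def upJumpLaw (P : Measure Ω) (ξ : ℝ≥0 → Ω → ℝ) (B s x : ℝ) : Measure ℝ :=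
  ((upLaw P ξ s x).map (fun r => r - B)).restrict (Set.Ioi 0)

/-- `E[e^{-sτ_x}; T_x - B ∈ du]`, `u > 0`. -/
def downJumpLaw (P : Measure Ω) (ξ : ℝ≥0 → Ω → ℝ) (B s x : ℝ) : Measure ℝ :=
  ((downLaw P ξ s x).map (fun r => r - B)).restrict (Set.Ioi 0)

/-- `Q₊(v,du,s) = ∫ E[e^{-sτ_v}; T_v - B ∈ dl] E[e^{-sτ^l}; T^l - B ∈ du]`. -/
def Qplus (P : Measure Ω) (ξ : ℝ≥0 → Ω → ℝ) (B s v : ℝ) : Measure ℝ :=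
  (downJumpLaw P ξ B s v).bind (upJumpLaw P ξ B s)

/-- `Q₋(v,du,s) = ∫ E[e^{-sτ^v}; T^v - B ∈ dl] E[e^{-sτ_l}; T_l - B ∈ du]`. -/
def Qminus (P : Measure Ω) (ξ : ℝ≥0 → Ω → ℝ) (B s v : ℝ) : Measure ℝ :=
  (upJumpLaw P ξ B s v).bind (downJumpLaw P ξ B s)

/-- Successive iterations of a kernel: `iterKernel Q n` is the iterate `Q^{(n+1)}`, with
`Q^{(1)} = Q` and `Q^{(n+1)}(v,du) = ∫ Q^{(n)}(v,dl) Q(l,du)`. -/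
def iterKernel (Q : ℝ → Measure ℝ) : ℕ → ℝ → Measure ℝ
  | 0 => Q
  | n + 1 => fun v => (iterKernel Q n v).bind Q

/-- The Neumann series `δ_v(du) + ∑_{n ≥ 1} Q^{(n)}(v,du)`. -/
def resolventKernel (Q : ℝ → Measure ℝ) (v : ℝ) : Measure ℝ :=
  Measure.dirac v + Measure.sum (fun n => iterKernel Q n v)

/-- `b(y,du,s) = E[e^{-sχ̄(y)}; X̄(y) ∈ du]` for real `y`; thus `b^v` is the case `y = v + B`
and `b_v` the case `y = -v`. -/
def entryLaw (P : Measure Ω) (ξ : ℝ≥0 → Ω → ℝ) (B s y : ℝ) : Measure ℝ :=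
  transform P s (entryTime ξ B y) (entryPos ξ B y) Set.univ

/-- `E[e^{-sχ(y)}; X(y) ∈ dv, A^B]`, with overshoot `X(y) = y + ξ(χ(y)) - B`. -/
def exitAboveLaw (P : Measure Ω) (ξ : ℝ≥0 → Ω → ℝ) (B s y : ℝ) : Measure ℝ :=
  transform P s (exitTime ξ B y) (fun ω => exitPos ξ B y ω - B) (exitAbove ξ B y)

/-- `E[e^{-sχ(y)}; X(y) ∈ dv, A_0]`, with overshoot `X(y) = -(y + ξ(χ(y)))`. -/
def exitBelowLaw (P : Measure Ω) (ξ : ℝ≥0 → Ω → ℝ) (B s y : ℝ) : Measure ℝ :=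
  transform P s (exitTime ξ B y) (fun ω => -exitPos ξ B y ω) (exitBelow ξ B y)

/-- The process `z + ξ` spends no time at the two boundary points `0` and `B`: for Lebesgue
almost every `t ≥ 0` it is almost surely at neither of them. For `z ∉ [0,B]` this can fail only
if `ξ` is a compound Poisson process whose jump law has atoms, and then for countably many `z`. -/
def NoTimeAtEnds (P : Measure Ω) (ξ : ℝ≥0 → Ω → ℝ) (B z : ℝ) : Prop :=
  ∀ᵐ t ∂((volume : Measure ℝ).restrict (Set.Ici 0)),
    P {ω | z + ξ t.toNNReal ω = 0 ∨ z + ξ t.toNNReal ω = B} = 0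

end LevyEntry

end

/-!
All laws in the theorem are functionals of the path, so everything is proved for the coordinate
process on the space `CadlagPath` of right-continuous paths with left limits, under the law of
`ξ`, and carried back by `path`.

* *Restarting.* A Lévy process starts afresh at every optional time (`strongMarkov`, from the
  simple Markov property by approximation from the right). Passage times over levels and exit
  times from `[0,B]` are hitting times of open sets, hence optional.

* *Measurability of the entry.* Entry into the closed interval is a closed-set hitting problem.
  By quasi-left-continuity (`quasiLeftContinuous`) the path is, almost surely, in the closed set
  at the limit of its hitting times of shrinking neighbourhoods, and this limit is measurable. So
  the entry time agrees almost surely with a measurable functional, and the strong Markov property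
  at the exit time gives the formula for a start inside the interval (`entryLaw_inside`).

* *No touching.* For a start `v + B` above the interval, the first passage below `B` is followed
  at once by an entry or by a jump to the other side, unless the path touches the level `B` from
  above, without crossing it, before that passage. Touching has probability zero
  (`ae_not_touches`) when no time is spent at the level. If the process spends no time at its
  starting point either, the levels at which the passage time jumps are countably many for each
  path, and the position of the process at a random time has no atoms. If it does spend time at
  its starting point, touching the level with positive probability would mean, by the strong
  Markov property, spending time there.

* *First-step equations.* Hence `b^v` is the law of the entry by the passage below `B`, plus the
  average of `b_l` over the jumps to `-l` (`entryLaw_down`), and reflection `ξ ↦ -ξ` gives the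
  equation for `b_l` (`entryLaw_up`). That no time is spent at the two ends passes to almost every
  landing point (`ae_avoids_down`, `ae_avoids_up`).

* *Iteration.* Two steps give a renewal equation `b = g + Q₊ b`. A jump over the interval needs
  a passage over distance `B`, which takes a time bounded below with positive probability, so
  discounting makes the mass of `Q₊` at most some `ρ < 1` (`exists_Qplus_le`). The Neumann series
  therefore converges geometrically, to the only bounded solution
  (`eq_lintegral_resolventKernel`).
-/

noncomputable section

namespace LevyEntry

/-! ### The space of càdlàg paths -/

/-- Right-continuous real paths with left limits, started at `0`, with the σ-algebra generated by
the coordinates. -/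
abbrev CadlagPath : Type :=
  {w : ℝ≥0 → ℝ // w 0 = 0 ∧ (∀ t, ContinuousWithinAt w (Set.Ici t) t) ∧
    ∀ t, ∃ l : ℝ, Filter.Tendsto w (𝓝[<] t) (𝓝 l)}

/-- The coordinate process on the path space. -/
def coord (t : ℝ≥0) (w : CadlagPath) : ℝ := w.1 t

lemma coord_zero (w : CadlagPath) : coord 0 w = 0 := w.2.1

lemma coord_rightCont (w : CadlagPath) (t : ℝ≥0) :
    ContinuousWithinAt (fun r => coord r w) (Set.Ici t) t := w.2.2.1 t

lemma coord_leftLim (w : CadlagPath) (t : ℝ≥0) :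
    ∃ l : ℝ, Filter.Tendsto (fun r => coord r w) (𝓝[<] t) (𝓝 l) := w.2.2.2 t

lemma measurable_coord (t : ℝ≥0) : Measurable (coord t) :=
  (measurable_pi_apply t).comp measurable_subtype_coe

/-- A map into the path space is measurable as soon as its coordinates are. -/
lemma measurable_toPath {α : Type*} [MeasurableSpace α] {f : α → CadlagPath}
    (h : ∀ t, Measurable fun a => coord t (f a)) : Measurable f :=
  Measurable.subtype_mk (h := fun a => (f a).2) (measurable_pi_lambda _ h)

/-- The smallest point of the grid of mesh `1/(n+1)` strictly to the right of `t`. -/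
def gridUp (n : ℕ) (t : ℝ≥0) : ℝ≥0 := ((⌊t * (n + 1)⌋₊ + 1 : ℕ) : ℝ≥0) / (n + 1)

lemma lt_gridUp (n : ℕ) (t : ℝ≥0) : t < gridUp n t := by
  rw [gridUp, lt_div_iff₀ (by positivity)]
  exact_mod_cast Nat.lt_floor_add_one (t * (n + 1))

lemma gridUp_le (n : ℕ) (t : ℝ≥0) : gridUp n t ≤ t + 1 / (n + 1) := by
  rw [gridUp, div_le_iff₀ (by positivity), add_mul, one_div,
    inv_mul_cancel₀ (by positivity)]
  push_cast
  gcongr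
  exact Nat.floor_le (by positivity)

lemma tendsto_gridUp (t : ℝ≥0) : Filter.Tendsto (fun n => gridUp n t) Filter.atTop (𝓝 t) := by
  refine tendsto_of_tendsto_of_tendsto_of_le_of_le tendsto_const_nhds ?_
    (fun n => (lt_gridUp n t).le) (fun n => gridUp_le n t)
  have h : Filter.Tendsto (fun n : ℕ => (1 : ℝ≥0) / (n + 1)) Filter.atTop (𝓝 0) :=
    tendsto_one_div_add_atTop_nhds_zero_nat
  simpa using h.const_add t

lemma tendsto_coord_of_ge {w : CadlagPath} {t : ℝ≥0} {r : ℕ → ℝ≥0}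
    (hr : Filter.Tendsto r Filter.atTop (𝓝 t)) (h : ∀ n, t ≤ r n) :
    Filter.Tendsto (fun n => coord (r n) w) Filter.atTop (𝓝 (coord t w)) :=
  (coord_rightCont w t).tendsto.comp
    (tendsto_nhdsWithin_of_tendsto_nhds_of_eventually_within _ hr (Filter.Eventually.of_forall h))

lemma tendsto_coord_gridUp (w : CadlagPath) (t : ℝ≥0) :
    Filter.Tendsto (fun n => coord (gridUp n t) w) Filter.atTop (𝓝 (coord t w)) :=
  tendsto_coord_of_ge (tendsto_gridUp t) fun n => (lt_gridUp n t).le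

lemma measurable_coord_uncurry : Measurable fun p : ℝ≥0 × CadlagPath => coord p.1 p.2 := by
  have hlim : Filter.Tendsto (fun n (p : ℝ≥0 × CadlagPath) => coord (gridUp n p.1) p.2)
      Filter.atTop (𝓝 fun p => coord p.1 p.2) := by
    rw [tendsto_pi_nhds]
    intro p
    exact tendsto_coord_gridUp p.2 p.1
  refine measurable_of_tendsto_metrizable (fun n => ?_) hlim
  have h1 : Measurable fun q : ℕ × CadlagPath => coord (((q.1 + 1 : ℕ) : ℝ≥0) / (n + 1)) q.2 :=
    measurable_from_prod_countable_right fun k =>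
      measurable_coord (((k + 1 : ℕ) : ℝ≥0) / (n + 1))
  have h2 : Measurable fun t : ℝ≥0 => ⌊t * ((n : ℝ≥0) + 1)⌋₊ :=
    Nat.measurable_floor.comp (measurable_id.mul_const _)
  exact h1.comp ((h2.comp measurable_fst).prodMk measurable_snd)

lemma measurable_coord_comp {α : Type*} [MeasurableSpace α] {f : α → ℝ≥0} {g : α → CadlagPath}
    (hf : Measurable f) (hg : Measurable g) : Measurable fun a => coord (f a) (g a) :=
  measurable_coord_uncurry.comp (hf.prodMk hg)

/-- The path after time `r`, restarted at `0`. -/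
def shift (r : ℝ≥0) (w : CadlagPath) : CadlagPath := by
  refine ⟨fun t => coord (r + t) w - coord r w, by simp, fun t => ?_, fun t => ?_⟩
  · refine ContinuousWithinAt.sub ?_ continuousWithinAt_const
    refine (coord_rightCont w (r + t)).comp (by fun_prop) fun x hx => ?_
    simpa using hx
  · obtain ⟨l, hl⟩ := coord_leftLim w (r + t)
    refine ⟨l - coord r w, Filter.Tendsto.sub_const ?_ _⟩
    refine hl.comp (tendsto_nhdsWithin_of_tendsto_nhds_of_eventually_within _ ?_ ?_)
    · exact ((continuous_const.add continuous_id).tendsto t).mono_left nhdsWithin_le_nhds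
    · filter_upwards [self_mem_nhdsWithin] with x hx
      simpa using hx

lemma coord_shift (r t : ℝ≥0) (w : CadlagPath) :
    coord t (shift r w) = coord (r + t) w - coord r w := rfl

lemma measurable_shift_comp {α : Type*} [MeasurableSpace α] {f : α → ℝ≥0} {g : α → CadlagPath}
    (hf : Measurable f) (hg : Measurable g) : Measurable fun a => shift (f a) (g a) :=
  measurable_toPath fun t => by
    simp only [coord_shift]
    exact (measurable_coord_comp (hf.add_const t) hg).sub (measurable_coord_comp hf hg)

lemma measurable_shift (r : ℝ≥0) : Measurable (shift r) :=
  measurable_shift_comp measurable_const measurable_id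

/-! ### Lévy processes and the simple Markov property -/

/-- The path of a Lévy process, as a point of the path space. -/
def path {Ω : Type*} [MeasurableSpace Ω] {P : Measure Ω} {ξ : ℝ≥0 → Ω → ℝ}
    (h : IsLevyProcess P ξ) (ω : Ω) : CadlagPath :=
  ⟨fun t => ξ t ω, h.zero ω, h.rightCont ω, h.leftLim ω⟩

section Levy

variable {Ω : Type*} [MeasurableSpace Ω] {P : Measure Ω} {ξ : ℝ≥0 → Ω → ℝ}

lemma measurable_path (h : IsLevyProcess P ξ) : Measurable (path h) :=
  measurable_toPath h.measurable

/-- Every finite set of times lies on a monotone sequence of times started at `0`. -/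
lemma exists_monotone_seq (A : Finset ℝ≥0) :
    ∃ t : ℕ → ℝ≥0, Monotone t ∧ t 0 = 0 ∧ ∃ N, ∀ a ∈ A, ∃ k < N, t k = a := by
  classical
  let C := insert 0 A
  have hpos : 0 < C.card := Finset.card_pos.2 ⟨0, Finset.mem_insert_self _ _⟩
  let e := C.orderEmbOfFin rfl
  refine ⟨fun k => e ⟨min k (C.card - 1), by omega⟩, fun a b hab => ?_, ?_, C.card, fun a ha => ?_⟩
  · exact e.monotone (by simp only [Fin.mk_le_mk]; omega)
  · obtain ⟨k, hk⟩ : (0 : ℝ≥0) ∈ Set.range e := by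
      rw [Finset.range_orderEmbOfFin]; exact Finset.mem_insert_self _ _
    refine le_antisymm ?_ (zero_le)
    calc e ⟨min 0 (C.card - 1), _⟩ ≤ e k := e.monotone (by simp [Fin.le_def])
      _ = 0 := hk
  · obtain ⟨k, hk⟩ : a ∈ Set.range e := by
      rw [Finset.range_orderEmbOfFin]; exact Finset.mem_insert_of_mem ha
    refine ⟨k, k.2, ?_⟩
    rw [← hk]
    have h1 := k.2
    have h2 : min (k : ℕ) (C.card - 1) = k := by omega
    simp only [h2]

lemma measurable_increment (h : IsLevyProcess P ξ) (a b : ℝ≥0) :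
    Measurable fun ω => ξ b ω - ξ a ω :=
  (h.measurable b).sub (h.measurable a)

lemma measurable_coord_increment (a b : ℝ≥0) : Measurable fun w => coord b w - coord a w :=
  (measurable_coord b).sub (measurable_coord a)

/-- The path up to time `r` is independent of the path after time `r`. -/
lemma indepFun_shift [IsProbabilityMeasure P] (h : IsLevyProcess P ξ) (r : ℝ≥0) :
    IndepFun (fun ω (t : Set.Iic r) => ξ t ω) (fun ω t => ξ (r + t) ω - ξ r ω) P := by
  classical
  refine IndepFun.process_indepFun_process (fun t => h.measurable t)
    (fun t => measurable_increment h _ _) fun I J => ?_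
  obtain ⟨t, tmono, t0, N, hN⟩ := exists_monotone_seq
    (insert r (I.image (fun i : Set.Iic r => (i : ℝ≥0)) ∪ J.image (fun j => r + j)))
  obtain ⟨m, hmN, hm⟩ := hN r (Finset.mem_insert_self _ _)
  have hI : ∀ i : I, ∃ k ≤ m, t k = i := fun i => by
    obtain ⟨k, -, hk⟩ := hN (i : Set.Iic r) (Finset.mem_insert_of_mem
      (Finset.mem_union_left _ (Finset.mem_image_of_mem _ i.2)))
    rcases le_total k m with hkm | hkm
    · exact ⟨k, hkm, hk⟩
    · refine ⟨m, le_rfl, le_antisymm ?_ ?_⟩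
      · rw [← hk]; exact tmono hkm
      · rw [hm]; exact i.1.2
  have hJ : ∀ j : J, ∃ k, m ≤ k ∧ k ≤ N ∧ t k = r + j := fun j => by
    obtain ⟨k, hkN, hk⟩ := hN (r + j) (Finset.mem_insert_of_mem
      (Finset.mem_union_right _ (Finset.mem_image_of_mem _ j.2)))
    rcases le_total m k with hkm | hkm
    · exact ⟨k, hkm, hkN.le, hk⟩
    · refine ⟨m, le_rfl, hmN.le, le_antisymm ?_ ?_⟩
      · rw [hm]; exact le_self_add
      · rw [← hk]; exact tmono hkm
  choose kI hkI hkI' using hI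
  choose kJ hkJ hkJN hkJ' using hJ
  -- The increments with index below `m` end before `r`, the others start after `r`. Values up to
  -- `r` are partial sums of the former, increments after `r` partial sums of the latter.
  have hind := (h.indep.nat tmono).indepFun_finset (Finset.range m) (Finset.Ico m N)
    (by
      rw [Finset.disjoint_left]
      intro a ha hb
      simp only [Finset.mem_range, Finset.mem_Ico] at ha hb
      omega)
    (fun i => measurable_increment h _ _)
  let fI : (Finset.range m → ℝ) → (I → ℝ) := fun x i =>
    ∑ k : Finset.range m, if (k : ℕ) < kI i then x k else 0
  let fJ : (Finset.Ico m N → ℝ) → (J → ℝ) := fun x j =>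
    ∑ k : Finset.Ico m N, if (k : ℕ) < kJ j then x k else 0
  have hfI : Measurable fI := measurable_pi_lambda _ fun i => Finset.measurable_sum _ fun k _ => by
    split_ifs <;> fun_prop
  have hfJ : Measurable fJ := measurable_pi_lambda _ fun j => Finset.measurable_sum _ fun k _ => by
    split_ifs <;> fun_prop
  have := hind.comp hfI hfJ
  convert this using 1
  · funext ω i
    simp only [fI, Function.comp]
    rw [Finset.sum_coe_sort (Finset.range m)
      (fun k => if k < kI i then ξ (t (k + 1)) ω - ξ (t k) ω else 0), ← Finset.sum_filter]
    have : (Finset.range m).filter (fun k => k < kI i) = Finset.range (kI i) := by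
      ext k; simp only [Finset.mem_filter, Finset.mem_range]; have := hkI i; omega
    rw [this, Finset.sum_range_sub (fun k => ξ (t k) ω), t0, h.zero, hkI' i, sub_zero]
  · funext ω j
    simp only [fJ, Function.comp]
    rw [Finset.sum_coe_sort (Finset.Ico m N)
      (fun k => if k < kJ j then ξ (t (k + 1)) ω - ξ (t k) ω else 0), ← Finset.sum_filter]
    have : (Finset.Ico m N).filter (fun k => k < kJ j) = Finset.Ico m (kJ j) := by
      ext k; simp only [Finset.mem_filter, Finset.mem_Ico]; have := hkJN j; omega
    rw [this, Finset.sum_Ico_sub (fun k => ξ (t k) ω) (hkJ j), hkJ' j, hm]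

lemma identDistrib_increment [IsProbabilityMeasure P] (h : IsLevyProcess P ξ) {a b : ℝ≥0}
    (hab : a ≤ b) :
    IdentDistrib (fun ω => ξ b ω - ξ a ω) (ξ (b - a)) P P := by
  have := h.stationary a (b - a)
  rwa [add_tsub_cancel_of_le hab] at this

/-- The path after time `r` has the law of the process. -/
lemma identDistrib_shift [IsProbabilityMeasure P] (h : IsLevyProcess P ξ) (r : ℝ≥0) :
    IdentDistrib (fun ω t => ξ (r + t) ω - ξ r ω) (fun ω t => ξ t ω) P P := by
  classical
  rw [identDistrib_iff_forall_finset_identDistrib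
    (measurable_pi_lambda _ fun t => measurable_increment h _ _).aemeasurable
    (measurable_pi_lambda _ fun t => h.measurable _).aemeasurable]
  intro J
  obtain ⟨t, tmono, t0, N, hN⟩ := exists_monotone_seq J
  choose kJ hkJN hkJ using fun j : J => hN j j.2
  have hid : IdentDistrib
      (fun ω (i : Fin N) => ξ (r + t (i + 1)) ω - ξ (r + t i) ω)
      (fun ω (i : Fin N) => ξ (t (i + 1)) ω - ξ (t i) ω) P P := by
    refine IdentDistrib.pi (fun i => ?_) ?_ ?_
    · refine (identDistrib_increment h (by gcongr; exact tmono (Nat.le_succ _))).trans ?_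
      rw [add_tsub_add_eq_tsub_left]
      exact (identDistrib_increment h (tmono (Nat.le_succ _))).symm
    · exact (h.indep.nat (t := fun k => r + t k) (fun a b hab => by
        dsimp only; gcongr; exact tmono hab)).precomp Fin.val_injective
    · exact (h.indep.nat tmono).precomp Fin.val_injective
  -- Values are partial sums of increments, and the increments have the same joint law.
  let f : (Fin N → ℝ) → (J → ℝ) := fun x j => ∑ k : Fin N, if (k : ℕ) < kJ j then x k else 0
  have hf : Measurable f := measurable_pi_lambda _ fun i => Finset.measurable_sum _ fun k _ => by
    split_ifs <;> fun_prop
  have key : ∀ (g : ℕ → ℝ) (j : J),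
      (∑ k : Fin N, if (k : ℕ) < kJ j then g (k + 1) - g k else 0) = g (kJ j) - g 0 := by
    intro g j
    rw [Fin.sum_univ_eq_sum_range (fun k => if k < kJ j then g (k + 1) - g k else 0),
      ← Finset.sum_filter]
    have : (Finset.range N).filter (fun k => k < kJ j) = Finset.range (kJ j) := by
      ext k; simp only [Finset.mem_filter, Finset.mem_range]; have := hkJN j; omega
    rw [this, Finset.sum_range_sub]
  convert hid.comp hf using 1
  · funext ω j
    simp only [f, Function.comp, Finset.restrict]
    rw [key (fun k => ξ (r + t k) ω) j, hkJ, t0, add_zero]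
  · funext ω j
    simp only [f, Function.comp, Finset.restrict]
    rw [key (fun k => ξ (t k) ω) j, hkJ, t0, h.zero, sub_zero]

/-- The law of a Lévy process on the path space makes the coordinate process a Lévy process. -/
lemma isLevyProcess_map_path [IsProbabilityMeasure P] (h : IsLevyProcess P ξ) :
    IsLevyProcess (P.map (path h)) coord where
  measurable := measurable_coord
  zero := coord_zero
  rightCont w t := coord_rightCont w t
  leftLim w t := coord_leftLim w t
  indep n t ht := by
    have hP := h.indep n t ht
    have := Measure.isProbabilityMeasure_map (μ := P) (measurable_path h).aemeasurable
    rw [iIndepFun_iff_map_fun_eq_pi_map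
      (fun i => (measurable_coord_increment _ _).aemeasurable)]
    rw [iIndepFun_iff_map_fun_eq_pi_map
      (fun i => (measurable_increment h _ _).aemeasurable)] at hP
    rw [Measure.map_map (measurable_pi_lambda _ fun i =>
      measurable_coord_increment _ _) (measurable_path h)]
    refine hP.trans ?_
    congr 1
    funext i
    rw [Measure.map_map (measurable_coord_increment _ _) (measurable_path h)]
    rfl
  stationary r t := by
    refine ⟨(measurable_coord_increment _ _).aemeasurable,
      (measurable_coord _).aemeasurable, ?_⟩
    rw [Measure.map_map (measurable_coord_increment _ _) (measurable_path h),
      Measure.map_map (measurable_coord _) (measurable_path h)]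
    exact (h.stationary r t).map_eq

/-- The reflected process is again a Lévy process. -/
lemma IsLevyProcess.neg (h : IsLevyProcess P ξ) : IsLevyProcess P (fun t ω => -ξ t ω) where
  measurable t := (h.measurable t).neg
  zero ω := by simp [h.zero]
  rightCont ω t := (h.rightCont ω t).neg
  leftLim ω t := (h.leftLim ω t).imp' Neg.neg fun l hl => hl.neg
  indep := h.indep.neg
  stationary r t := by
    convert (h.stationary r t).comp measurable_neg using 1
    · funext ω
      simp only [Function.comp]
      ring
    · rfl

end Levy

/-! ### The strong Markov property -/

/-- The σ-algebra of the path up to time `t`. -/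
@[reducible]
def past (t : ℝ≥0) : MeasurableSpace CadlagPath :=
  MeasurableSpace.comap (fun w (q : Set.Iic t) => coord q w) inferInstance

lemma past_le (t : ℝ≥0) : past t ≤ (inferInstance : MeasurableSpace CadlagPath) :=
  (measurable_pi_lambda _ fun _ => measurable_coord _).comap_le

lemma measurable_past_coord {r t : ℝ≥0} (h : r ≤ t) : Measurable[past t] (coord r) :=
  (measurable_pi_apply (⟨r, h⟩ : Set.Iic t)).comp
    (comap_measurable (fun w (q : Set.Iic t) => coord q w))

lemma past_mono {r t : ℝ≥0} (h : r ≤ t) : past r ≤ past t := by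
  refine Measurable.comap_le ?_
  exact @measurable_pi_lambda _ _ _ (past t) _ _ fun q => measurable_past_coord (q.2.trans h)

/-- A random time `τ` is optional when for every `t` the event `τ < t` is decided by the path up
to time `t`. -/
def IsOptional (τ : CadlagPath → ℝ≥0∞) : Prop :=
  ∀ t : ℝ≥0, MeasurableSet[past t] {w | τ w < t}

lemma measurable_gridUp (n : ℕ) : Measurable (gridUp n) := by
  unfold gridUp
  refine Measurable.div_const ?_ _
  refine (measurable_from_nat (f := fun k : ℕ => ((k + 1 : ℕ) : ℝ≥0))).comp ?_
  exact Nat.measurable_floor.comp (measurable_id.mul_const _)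

lemma IsOptional.measurable {τ : CadlagPath → ℝ≥0∞} (h : IsOptional τ) : Measurable τ := by
  refine measurable_of_Iio fun a => ?_
  induction a using ENNReal.recTopCoe with
  | coe t => exact past_le t _ (h t)
  | top =>
    have : τ ⁻¹' Set.Iio ∞ = ⋃ n : ℕ, {w | τ w < ((n : ℝ≥0) : ℝ≥0∞)} := by
      ext w
      simp only [Set.mem_preimage, Set.mem_Iio, Set.mem_iUnion, Set.mem_ofPred_eq]
      refine ⟨fun hw => ?_, fun ⟨n, hn⟩ => hn.trans ENNReal.coe_lt_top⟩
      obtain ⟨n, hn⟩ := ENNReal.exists_nat_gt hw.ne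
      exact ⟨n, by simpa using hn⟩
    rw [this]
    exact MeasurableSet.iUnion fun n => past_le _ _ (h n)

/-- Finite measures on the path space are determined by their finite-dimensional marginals. -/
lemma pathMeasure_ext {μ ν : Measure CadlagPath} [IsFiniteMeasure μ] [IsFiniteMeasure ν]
    (h : ∀ (J : Finset ℝ≥0) (g : BoundedContinuousFunction (J → ℝ) ℝ),
      ∫ w, g (fun j => coord j w) ∂μ = ∫ w, g (fun j => coord j w) ∂ν) : μ = ν := by
  have hval : Measurable (Subtype.val : CadlagPath → ℝ≥0 → ℝ) := measurable_subtype_coe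
  have key : μ.map (Subtype.val : CadlagPath → ℝ≥0 → ℝ) = ν.map Subtype.val := by
    refine IsProjectiveLimit.unique (P := fun I : Finset ℝ≥0 => (ν.map Subtype.val).map I.restrict)
      (fun J => ?_) (fun J => rfl)
    dsimp only
    rw [Measure.map_map (Finset.measurable_restrict _) hval,
      Measure.map_map (Finset.measurable_restrict _) hval]
    refine ext_of_forall_integral_eq_of_IsFiniteMeasure fun g => ?_
    rw [integral_map ((Finset.measurable_restrict _).comp hval).aemeasurable
        g.continuous.measurable.aestronglyMeasurable,
      integral_map ((Finset.measurable_restrict _).comp hval).aemeasurable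
        g.continuous.measurable.aestronglyMeasurable]
    exact h J g
  ext s hs
  obtain ⟨t, ht, rfl⟩ := hs
  rw [← Measure.map_apply hval ht, key, Measure.map_apply hval ht]

section Markov

variable {μ : Measure CadlagPath} [IsProbabilityMeasure μ]

/-- The simple Markov property, in integrated form. -/
lemma integral_mul_shift (h : IsLevyProcess μ coord) (r : ℝ≥0) {U : CadlagPath → ℝ}
    (hU : Measurable[past r] U) (J : Finset ℝ≥0) (g : BoundedContinuousFunction (J → ℝ) ℝ) :
    ∫ w, U w * g (fun j => coord j (shift r w)) ∂μ =
      (∫ w, U w ∂μ) * ∫ w, g (fun j => coord j w) ∂μ := by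
  have hG : Measurable fun x : ℝ≥0 → ℝ => g fun j : J => x j :=
    g.continuous.measurable.comp (measurable_pi_lambda _ fun j => measurable_pi_apply _)
  have hind : IndepFun U (fun w => g fun j => coord j (shift r w)) μ := by
    have h1 := (indepFun_shift h r).comp measurable_id hG
    rw [IndepFun_iff_Indep] at h1 ⊢
    exact indep_of_indep_of_le_left h1 hU.comap_le
  have hg : Measurable fun w => g fun j => coord j (shift r w) :=
    hG.comp (measurable_pi_lambda _ fun t => (measurable_coord t).comp (measurable_shift r))
  rw [hind.integral_fun_mul_eq_mul_integral (hU.mono (past_le r) le_rfl).aestronglyMeasurable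
    hg.aestronglyMeasurable]
  congr 1
  exact ((identDistrib_shift h r).comp hG).integral_eq

/-- The strong Markov property at a discretized optional time, against test functions. -/
lemma integral_gridUp (h : IsLevyProcess μ coord) {τ : CadlagPath → ℝ≥0∞} (hτ : IsOptional τ)
    (n : ℕ) (f : BoundedContinuousFunction (ℝ≥0 × ℝ) ℝ)
    (J : Finset ℝ≥0) (g : BoundedContinuousFunction (J → ℝ) ℝ) :
    ∫ w in {w | τ w < ∞}, f (gridUp n (τ w).toNNReal, coord (gridUp n (τ w).toNNReal) w) *
        g (fun j => coord j (shift (gridUp n (τ w).toNNReal) w)) ∂μ =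
      (∫ w in {w | τ w < ∞}, f (gridUp n (τ w).toNNReal, coord (gridUp n (τ w).toNNReal) w) ∂μ) *
        ∫ w, g (fun j => coord j w) ∂μ := by
  -- `A k` is the event that `τ` lies in the `k`-th cell of the grid. On it, `gridUp n τ` is the
  -- constant right end of the cell, at which the event is already decided.
  let A : ℕ → Set CadlagPath := fun k => {w | τ w < ((((k + 1 : ℕ) : ℝ≥0) / (n + 1) : ℝ≥0) : ℝ≥0∞)} \
    {w | τ w < (((k : ℝ≥0) / (n + 1) : ℝ≥0) : ℝ≥0∞)}
  have hApast : ∀ k, MeasurableSet[past (((k + 1 : ℕ) : ℝ≥0) / (n + 1))] (A k) := fun k =>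
    (hτ _).diff (past_mono (by gcongr; exact Nat.le_succ _) _ (hτ _))
  have hA : ∀ k, MeasurableSet (A k) := fun k => past_le _ _ (hApast k)
  have hmem : ∀ k w, w ∈ A k ↔ τ w < ∞ ∧ ⌊(τ w).toNNReal * (n + 1)⌋₊ = k := by
    intro k w
    simp only [A, Set.mem_sdiff, Set.mem_ofPred_eq, not_lt]
    rcases eq_or_ne (τ w) ∞ with ht | ht
    · simp [ht]
    · lift τ w to ℝ≥0 using ht with t
      simp only [ENNReal.coe_lt_coe, ENNReal.coe_le_coe, ENNReal.coe_lt_top, true_and,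
        ENNReal.toNNReal_coe]
      rw [lt_div_iff₀ (by positivity), div_le_iff₀ (by positivity), Nat.floor_eq_iff (by positivity)]
      push_cast
      exact and_comm
  have hunion : {w | τ w < ∞} = ⋃ k, A k := by
    ext w
    simp [hmem]
  have hdisj : Pairwise (Function.onFun Disjoint A) := fun k l hkl =>
    Set.disjoint_left.2 fun w hw hw' => hkl (((hmem k w).1 hw).2.symm.trans ((hmem l w).1 hw').2)
  have hgrid : ∀ k w, w ∈ A k → gridUp n (τ w).toNNReal = ((k + 1 : ℕ) : ℝ≥0) / (n + 1) :=
    fun k w hw => by rw [gridUp, ((hmem k w).1 hw).2]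
  have hgridm : Measurable fun w => gridUp n (τ w).toNNReal :=
    (measurable_gridUp n).comp hτ.measurable.ennreal_toNNReal
  have hfm : Measurable fun w =>
      f (gridUp n (τ w).toNNReal, coord (gridUp n (τ w).toNNReal) w) :=
    f.continuous.measurable.comp (hgridm.prodMk (measurable_coord_comp hgridm measurable_id))
  have hgm : Measurable fun w => g (fun j => coord j (shift (gridUp n (τ w).toNNReal) w)) :=
    g.continuous.measurable.comp (measurable_pi_lambda _ fun j =>
      (measurable_coord _).comp (measurable_shift_comp hgridm measurable_id))
  have hfi : Integrable (fun w =>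
      f (gridUp n (τ w).toNNReal, coord (gridUp n (τ w).toNNReal) w)) μ :=
    Integrable.of_bound hfm.aestronglyMeasurable ‖f‖ (ae_of_all _ fun w => f.norm_coe_le_norm _)
  have hfgi : Integrable (fun w =>
      f (gridUp n (τ w).toNNReal, coord (gridUp n (τ w).toNNReal) w) *
        g (fun j => coord j (shift (gridUp n (τ w).toNNReal) w))) μ :=
    hfi.mul_bdd (c := ‖g‖) hgm.aestronglyMeasurable (ae_of_all _ fun w => g.norm_coe_le_norm _)
  rw [hunion, integral_iUnion hA hdisj hfgi.integrableOn,
    integral_iUnion hA hdisj hfi.integrableOn, ← tsum_mul_right]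
  congr 1
  funext k
  set r : ℝ≥0 := ((k + 1 : ℕ) : ℝ≥0) / (n + 1) with hr
  have hU : Measurable[past r] ((A k).indicator fun w => f (r, coord r w)) := by
    refine Measurable.indicator ?_ (hApast k)
    exact f.continuous.measurable.comp (measurable_const.prodMk (measurable_past_coord le_rfl))
  have := integral_mul_shift h r hU J g
  rw [integral_indicator (hA k)] at this
  have hcongr : ∫ w in A k, f (gridUp n (τ w).toNNReal, coord (gridUp n (τ w).toNNReal) w) ∂μ =
      ∫ w in A k, f (r, coord r w) ∂μ :=
    setIntegral_congr_fun (hA k) fun w hw => by rw [hgrid k w hw]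
  rw [hcongr, ← this, ← integral_indicator (hA k)]
  refine integral_congr_ae (ae_of_all _ fun w => ?_)
  by_cases hw : w ∈ A k
  · simp only [Set.indicator_of_mem hw, hgrid k w hw, hr]
  · simp only [Set.indicator_of_notMem hw, zero_mul]

lemma integral_optional (h : IsLevyProcess μ coord) {τ : CadlagPath → ℝ≥0∞} (hτ : IsOptional τ)
    (f : BoundedContinuousFunction (ℝ≥0 × ℝ) ℝ)
    (J : Finset ℝ≥0) (g : BoundedContinuousFunction (J → ℝ) ℝ) :
    ∫ w in {w | τ w < ∞}, f ((τ w).toNNReal, coord (τ w).toNNReal w) *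
        g (fun j => coord j (shift (τ w).toNNReal w)) ∂μ =
      (∫ w in {w | τ w < ∞}, f ((τ w).toNNReal, coord (τ w).toNNReal w) ∂μ) *
        ∫ w, g (fun j => coord j w) ∂μ := by
  have hgridm : ∀ n, Measurable fun w => gridUp n (τ w).toNNReal := fun n =>
    (measurable_gridUp n).comp hτ.measurable.ennreal_toNNReal
  have hfm : ∀ n, Measurable fun w =>
      f (gridUp n (τ w).toNNReal, coord (gridUp n (τ w).toNNReal) w) := fun n =>
    f.continuous.measurable.comp
      ((hgridm n).prodMk (measurable_coord_comp (hgridm n) measurable_id))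
  have hgm : ∀ n, Measurable fun w => g (fun j => coord j (shift (gridUp n (τ w).toNNReal) w)) :=
    fun n => g.continuous.measurable.comp (measurable_pi_lambda _ fun j =>
      (measurable_coord _).comp (measurable_shift_comp (hgridm n) measurable_id))
  have hflim : ∀ w, Filter.Tendsto
      (fun n => f (gridUp n (τ w).toNNReal, coord (gridUp n (τ w).toNNReal) w)) Filter.atTop
      (𝓝 (f ((τ w).toNNReal, coord (τ w).toNNReal w))) := fun w =>
    (f.continuous.tendsto _).comp ((tendsto_gridUp _).prodMk_nhds (tendsto_coord_gridUp _ _))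
  have hglim : ∀ w, Filter.Tendsto
      (fun n => g (fun j => coord j (shift (gridUp n (τ w).toNNReal) w))) Filter.atTop
      (𝓝 (g (fun j => coord j (shift (τ w).toNNReal w)))) := fun w => by
    refine (g.continuous.tendsto _).comp (tendsto_pi_nhds.2 fun j => ?_)
    simp only [coord_shift]
    refine Filter.Tendsto.sub ?_ (tendsto_coord_gridUp _ _)
    exact tendsto_coord_of_ge ((tendsto_gridUp _).add_const _)
      fun n => by gcongr; exact (lt_gridUp _ _).le
  have h1 := tendsto_integral_of_dominated_convergence (μ := μ.restrict {w | τ w < ∞})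
    (F := fun n w => f (gridUp n (τ w).toNNReal, coord (gridUp n (τ w).toNNReal) w) *
        g (fun j => coord j (shift (gridUp n (τ w).toNNReal) w)))
    (fun _ => ‖f‖ * ‖g‖) (fun n => ((hfm n).mul (hgm n)).aestronglyMeasurable)
    (integrable_const _)
    (fun n => ae_of_all _ fun w => by
      rw [norm_mul]
      exact mul_le_mul (f.norm_coe_le_norm _) (g.norm_coe_le_norm _) (norm_nonneg _)
        (norm_nonneg _))
    (ae_of_all _ fun w => (hflim w).mul (hglim w))
  have h2 := (tendsto_integral_of_dominated_convergence (μ := μ.restrict {w | τ w < ∞})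
    (F := fun n w => f (gridUp n (τ w).toNNReal, coord (gridUp n (τ w).toNNReal) w))
    (fun _ => ‖f‖) (fun n => (hfm n).aestronglyMeasurable)
    (integrable_const _) (fun n => ae_of_all _ fun w => f.norm_coe_le_norm _)
    (ae_of_all _ fun w => hflim w)).mul_const (∫ w, g (fun j => coord j w) ∂μ)
  refine tendsto_nhds_unique h1 (h2.congr fun n => ?_)
  exact (integral_gridUp h hτ n f J g).symm

/-- The strong Markov property: on the event that the optional time `τ` is finite, the path after
`τ` is a fresh copy of the process, independent of `τ` and of the position at `τ`. -/
theorem strongMarkov (h : IsLevyProcess μ coord) {τ : CadlagPath → ℝ≥0∞} (hτ : IsOptional τ)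
    {F : ℝ≥0 → ℝ → CadlagPath → ℝ≥0∞}
    (hF : Measurable fun p : (ℝ≥0 × ℝ) × CadlagPath => F p.1.1 p.1.2 p.2) :
    ∫⁻ w in {w | τ w < ∞}, F (τ w).toNNReal (coord (τ w).toNNReal w) (shift (τ w).toNNReal w) ∂μ =
      ∫⁻ w in {w | τ w < ∞}, ∫⁻ w', F (τ w).toNNReal (coord (τ w).toNNReal w) w' ∂μ ∂μ := by
  set A : Set CadlagPath := {w | τ w < ∞} with hAdef
  have hA : MeasurableSet A := hτ.measurable measurableSet_Iio
  have hτm : Measurable fun w => (τ w).toNNReal := hτ.measurable.ennreal_toNNReal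
  let Z : CadlagPath → ℝ≥0 × ℝ := fun w => ((τ w).toNNReal, coord (τ w).toNNReal w)
  have hZ : Measurable Z := hτm.prodMk (measurable_coord_comp hτm measurable_id)
  let S : CadlagPath → CadlagPath := fun w => shift (τ w).toNNReal w
  have hS : Measurable S := measurable_shift_comp hτm measurable_id
  rcases eq_or_ne (μ A) 0 with h0 | h0
  · rw [setLIntegral_measure_zero _ _ h0, setLIntegral_measure_zero _ _ h0]
  -- Independence and the law of the restarted path are stated under `μ` conditioned on `τ < ∞`.
  have hP : IsProbabilityMeasure (μ[|A]) := cond_isProbabilityMeasure h0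
  have hcond : ∀ φ : CadlagPath → ℝ, ∫ w, φ w ∂(μ[|A]) = (μ A)⁻¹.toReal * ∫ w in A, φ w ∂μ :=
    fun φ => by rw [ProbabilityTheory.cond, integral_smul_measure, smul_eq_mul]
  have hne : (μ A)⁻¹.toReal * (μ A).toReal = 1 := by
    rw [← ENNReal.toReal_mul, ENNReal.inv_mul_cancel h0 (measure_ne_top _ _), ENNReal.toReal_one]
  have hmarg : ∀ (J : Finset ℝ≥0) (g : BoundedContinuousFunction (J → ℝ) ℝ),
      ∫ w, g (fun j => coord j (S w)) ∂(μ[|A]) = ∫ w, g (fun j => coord j w) ∂μ := by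
    intro J g
    have := integral_optional h hτ (BoundedContinuousFunction.const _ 1) J g
    simp only [BoundedContinuousFunction.const_apply, one_mul, integral_const, smul_eq_mul,
      mul_one, measureReal_restrict_apply_univ] at this
    rw [hcond, this, ← mul_assoc, measureReal_def, hne, one_mul]
  have hlaw : (μ[|A]).map S = μ := by
    have := Measure.isProbabilityMeasure_map (μ := μ[|A]) hS.aemeasurable
    refine pathMeasure_ext fun J g => ?_
    rw [integral_map hS.aemeasurable, hmarg]
    exact (g.continuous.measurable.comp
      (measurable_pi_lambda _ fun j => measurable_coord _)).aestronglyMeasurable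
  have hind : IndepFun Z S (μ[|A]) := by
    have h1 : IndepFun Z (fun w t => coord t (S w)) (μ[|A]) := by
      refine indepFun_process_of_bcf hZ.aemeasurable
        (fun t => ((measurable_coord t).comp hS).aemeasurable) fun f J g => ?_
      rw [hmarg, hcond, hcond, mul_assoc]
      congr 1
      exact integral_optional h hτ f J g
    rw [IndepFun_iff_Indep] at h1 ⊢
    convert h1 using 1
    exact MeasurableSpace.comap_comp
  have hprod := (indepFun_iff_map_prod_eq_prod_map_map hZ.aemeasurable hS.aemeasurable).1 hind
  rw [hlaw] at hprod
  have hres : μ.restrict A = μ A • μ[|A] := by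
    rw [ProbabilityTheory.cond, smul_smul, ENNReal.mul_inv_cancel h0 (measure_ne_top _ _), one_smul]
  rw [hres, lintegral_smul_measure, lintegral_smul_measure]
  congr 1
  calc ∫⁻ w, F (τ w).toNNReal (coord (τ w).toNNReal w) (shift (τ w).toNNReal w) ∂(μ[|A])
      = ∫⁻ p, F p.1.1 p.1.2 p.2 ∂((μ[|A]).map fun w => (Z w, S w)) := by
        rw [lintegral_map hF (hZ.prodMk hS)]
    _ = ∫⁻ z, ∫⁻ w', F z.1 z.2 w' ∂μ ∂((μ[|A]).map Z) := by
        rw [hprod, lintegral_prod _ hF.aemeasurable]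
    _ = _ := by
        rw [lintegral_map hF.lintegral_prod_right' hZ]

end Markov

/-! ### First times and hitting times of open sets -/

lemma firstTime_lt_iff {S : Set ℝ≥0} {a : ℝ≥0∞} :
    firstTime S < a ↔ ∃ t ∈ S, (t : ℝ≥0∞) < a := by
  simp [firstTime, iInf_lt_iff]

lemma firstTime_le {S : Set ℝ≥0} {t : ℝ≥0} (h : t ∈ S) : firstTime S ≤ t := iInf₂_le t h

lemma le_firstTime {S : Set ℝ≥0} {a : ℝ≥0∞} (h : ∀ t ∈ S, a ≤ t) : a ≤ firstTime S :=
  le_iInf₂ h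

lemma firstTime_anti {S S' : Set ℝ≥0} (h : S ⊆ S') : firstTime S' ≤ firstTime S :=
  le_firstTime fun _ ht => firstTime_le (h ht)

lemma exists_seq_firstTime {S : Set ℝ≥0} (h : firstTime S < ∞) :
    ∃ u : ℕ → ℝ≥0, (∀ n, u n ∈ S) ∧ (∀ n, (firstTime S).toNNReal ≤ u n) ∧
      Filter.Tendsto u Filter.atTop (𝓝 (firstTime S).toNNReal) := by
  set τ := (firstTime S).toNNReal with hτ
  have hτ' : (τ : ℝ≥0∞) = firstTime S := ENNReal.coe_toNNReal h.ne
  have : ∀ n : ℕ, ∃ t ∈ S, t < τ + 1 / (n + 1) := fun n => by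
    have hlt : firstTime S < ((τ + 1 / (n + 1) : ℝ≥0) : ℝ≥0∞) := by
      rw [← hτ', ENNReal.coe_lt_coe]
      exact lt_add_of_pos_right _ (by positivity)
    obtain ⟨t, ht, hlt⟩ := firstTime_lt_iff.1 hlt
    exact ⟨t, ht, by exact_mod_cast hlt⟩
  choose u hu hlt using this
  have hge : ∀ n, τ ≤ u n := fun n => by
    rw [← ENNReal.coe_le_coe, hτ']
    exact firstTime_le (hu n)
  refine ⟨u, hu, hge, tendsto_of_tendsto_of_tendsto_of_le_of_le tendsto_const_nhds ?_ hge
    fun n => (hlt n).le⟩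
  have h0 : Filter.Tendsto (fun n : ℕ => (1 : ℝ≥0) / (n + 1)) Filter.atTop (𝓝 0) :=
    tendsto_one_div_add_atTop_nhds_zero_nat
  simpa using h0.const_add τ

lemma firstTime_eq_add {S : Set ℝ≥0} (r : ℝ≥0) (h : ∀ t ∈ S, r ≤ t) :
    firstTime S = r + firstTime {t | r + t ∈ S} := by
  refine le_antisymm ?_ (le_firstTime fun t ht => ?_)
  · rw [← tsub_le_iff_left]
    refine le_firstTime fun t ht => tsub_le_iff_left.2 ?_
    rw [← ENNReal.coe_add]
    exact firstTime_le ht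
  · obtain ⟨c, rfl⟩ := exists_add_of_le (h t ht)
    rw [ENNReal.coe_add]
    gcongr
    exact firstTime_le ht

/-- The first time at which `z + w` is in `G`. -/
def firstHit (G : Set ℝ) (z : ℝ) (w : CadlagPath) : ℝ≥0∞ := firstTime {t | z + coord t w ∈ G}

lemma firstHit_lt_iff {G : Set ℝ} (hG : IsOpen G) {z : ℝ} {w : CadlagPath} {a : ℝ≥0∞} :
    firstHit G z w < a ↔
      ∃ n, z + coord (TopologicalSpace.denseSeq ℝ≥0 n) w ∈ G ∧
        ((TopologicalSpace.denseSeq ℝ≥0 n : ℝ≥0) : ℝ≥0∞) < a := by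
  rw [firstHit, firstTime_lt_iff]
  refine ⟨fun ⟨t, ht, hta⟩ => ?_, fun ⟨n, hn, hna⟩ => ⟨_, hn, hna⟩⟩
  have h1 : ∀ᶠ r in 𝓝[≥] t, z + coord r w ∈ G :=
    (continuousWithinAt_const.add (coord_rightCont w t)).eventually_mem (hG.mem_nhds ht)
  have h2 : ∀ᶠ r : ℝ≥0 in 𝓝[≥] t, (r : ℝ≥0∞) < a :=
    (ENNReal.continuous_coe.continuousAt.eventually (gt_mem_nhds hta)).filter_mono
      nhdsWithin_le_nhds
  obtain ⟨u, hu, hsub⟩ := (mem_nhdsGE_iff_exists_Ico_subset' (lt_add_one t)).1 (h1.and h2)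
  obtain ⟨n, hn⟩ := (TopologicalSpace.denseRange_denseSeq ℝ≥0).exists_mem_open
    isOpen_Ioo (Set.nonempty_Ioo.2 hu)
  exact ⟨n, hsub ⟨hn.1.le, hn.2⟩⟩

lemma measurable_firstHit {G : Set ℝ} (hG : IsOpen G) :
    Measurable fun p : ℝ × CadlagPath => firstHit G p.1 p.2 := by
  refine measurable_of_Iio fun a => ?_
  have hm : ∀ q : ℝ≥0, MeasurableSet {p : ℝ × CadlagPath | p.1 + coord q p.2 ∈ G} := fun q =>
    measurableSet_preimage (measurable_fst.add ((measurable_coord q).comp measurable_snd))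
      hG.measurableSet
  have : (fun p : ℝ × CadlagPath => firstHit G p.1 p.2) ⁻¹' Set.Iio a =
      ⋃ n, ({p : ℝ × CadlagPath | p.1 + coord (TopologicalSpace.denseSeq ℝ≥0 n) p.2 ∈ G} ∩
        {_p | ((TopologicalSpace.denseSeq ℝ≥0 n : ℝ≥0) : ℝ≥0∞) < a}) := by
    refine Set.ext fun p => ?_
    rw [Set.mem_preimage, Set.mem_Iio, firstHit_lt_iff hG, Set.mem_iUnion]
    rfl
  rw [this]
  exact MeasurableSet.iUnion fun n => (hm _).inter (MeasurableSet.const _)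

lemma measurable_firstHit_comp {G : Set ℝ} (hG : IsOpen G) {α : Type*} [MeasurableSpace α]
    {f : α → ℝ} {g : α → CadlagPath} (hf : Measurable f) (hg : Measurable g) :
    Measurable fun a => firstHit G (f a) (g a) := by
  have h := (measurable_firstHit hG).comp (hf.prodMk hg)
  exact h

lemma isOptional_firstHit {G : Set ℝ} (hG : IsOpen G) (z : ℝ) : IsOptional (firstHit G z) := by
  intro t
  have : {w | firstHit G z w < t} =
      ⋃ n, {w | z + coord (TopologicalSpace.denseSeq ℝ≥0 n) w ∈ G ∧
        ((TopologicalSpace.denseSeq ℝ≥0 n : ℝ≥0) : ℝ≥0∞) < t} := by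
    ext p
    simp only [firstHit_lt_iff hG, Set.mem_iUnion, Set.mem_ofPred_eq]
  rw [this]
  refine @MeasurableSet.iUnion _ _ (past t) _ _ fun n => ?_
  by_cases hn : ((TopologicalSpace.denseSeq ℝ≥0 n : ℝ≥0) : ℝ≥0∞) < t
  · simp only [hn, and_true]
    exact ((measurable_past_coord (by exact_mod_cast hn.le)).const_add z) hG.measurableSet
  · simp only [hn, and_false]
    exact @MeasurableSet.empty _ (past t)

lemma isOptional_const (r : ℝ≥0) : IsOptional fun _ => (r : ℝ≥0∞) := fun _ =>
  MeasurableSet.const _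

lemma IsOptional.iSup {T : ℕ → CadlagPath → ℝ≥0∞} (h : ∀ n, IsOptional (T n)) :
    IsOptional fun w => ⨆ n, T n w := by
  intro t
  have : {w | ⨆ n, T n w < t} = ⋃ q : ℕ, ⋂ n,
      {w | TopologicalSpace.denseSeq ℝ≥0 q < t ∧ T n w < TopologicalSpace.denseSeq ℝ≥0 q} := by
    ext w
    simp only [Set.mem_ofPred_eq, Set.mem_iUnion, Set.mem_iInter]
    constructor
    · intro hw
      have hlt : (⨆ n, T n w).toNNReal < t := by
        rw [← ENNReal.coe_lt_coe, ENNReal.coe_toNNReal (hw.trans ENNReal.coe_lt_top).ne]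
        exact hw
      obtain ⟨q, hq⟩ := (TopologicalSpace.denseRange_denseSeq ℝ≥0).exists_mem_open
        isOpen_Ioo (Set.nonempty_Ioo.2 hlt)
      refine ⟨q, fun n => ⟨hq.2, (le_iSup (fun n => T n w) n).trans_lt ?_⟩⟩
      rw [← ENNReal.coe_toNNReal (hw.trans ENNReal.coe_lt_top).ne]
      exact_mod_cast hq.1
    · rintro ⟨q, hq⟩
      exact (iSup_le fun n => (hq n).2.le).trans_lt (by exact_mod_cast (hq 0).1)
  rw [this]
  refine @MeasurableSet.iUnion _ _ (past t) _ _ fun q =>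
    @MeasurableSet.iInter _ _ (past t) _ _ fun n => ?_
  by_cases hq : TopologicalSpace.denseSeq ℝ≥0 q < t
  · simp only [hq, true_and]
    exact past_mono hq.le _ (h n _)
  · simp only [hq, false_and]
    exact @MeasurableSet.empty _ (past t)

lemma firstHit_mem_closure {G : Set ℝ} {z : ℝ} {w : CadlagPath} (h : firstHit G z w < ∞) :
    z + coord (firstHit G z w).toNNReal w ∈ closure G := by
  obtain ⟨u, hu, hge, hlim⟩ := exists_seq_firstTime h
  exact mem_closure_of_tendsto ((tendsto_coord_of_ge hlim hge).const_add z)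
    (Filter.Eventually.of_forall hu)

section QuasiLeft

variable {μ : Measure CadlagPath} [IsProbabilityMeasure μ]

/-- An event of probability zero from every starting point stays so when the process is
restarted at an optional time. -/
lemma ae_shift (h : IsLevyProcess μ coord) {τ : CadlagPath → ℝ≥0∞} (hτ : IsOptional τ)
    {N : Set (ℝ × CadlagPath)} (hN : MeasurableSet N) (hnull : ∀ z, ∀ᵐ w ∂μ, (z, w) ∉ N) (z : ℝ) :
    ∀ᵐ w ∂μ, τ w < ∞ → (z + coord (τ w).toNNReal w, shift (τ w).toNNReal w) ∉ N := by
  have hτm : Measurable fun w => (τ w).toNNReal := hτ.measurable.ennreal_toNNReal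
  have hF : Measurable fun p : (ℝ≥0 × ℝ) × CadlagPath =>
      N.indicator (1 : ℝ × CadlagPath → ℝ≥0∞) (z + p.1.2, p.2) :=
    (measurable_one.indicator hN).comp
      (((measurable_snd.comp measurable_fst).const_add z).prodMk measurable_snd)
  have key := strongMarkov h hτ (F := fun _ x w' => N.indicator 1 (z + x, w')) hF
  have h0 : ∀ x, ∫⁻ w', N.indicator (1 : ℝ × CadlagPath → ℝ≥0∞) (x, w') ∂μ = 0 := fun x => by
    refine lintegral_eq_zero_of_ae_eq_zero ?_
    filter_upwards [hnull x] with w hw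
    simp [hw]
  simp only [h0, lintegral_zero] at key
  have hm : Measurable fun w =>
      N.indicator (1 : ℝ × CadlagPath → ℝ≥0∞)
        (z + coord (τ w).toNNReal w, shift (τ w).toNNReal w) :=
    hF.comp ((hτm.prodMk (measurable_coord_comp hτm measurable_id)).prodMk
      (measurable_shift_comp hτm measurable_id))
  rw [lintegral_eq_zero_iff hm, Filter.EventuallyEq,
    ae_restrict_iff' (show MeasurableSet {w | τ w < ∞} from hτ.measurable measurableSet_Iio)] at key
  filter_upwards [key] with w hw hlt hmem
  have := hw hlt
  simp [hmem] at this

/-- Quasi-left-continuity: a Lévy process is almost surely continuous along an increasing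
sequence of optional times. The increment over `[T n, T n + r]` has the law of the increment over
`[0, r]`; letting `n → ∞` and then `r → 0`, the former tends to the possible jump at the limit
time and the latter to `0`. -/
theorem quasiLeftContinuous (h : IsLevyProcess μ coord) {T : ℕ → CadlagPath → ℝ≥0∞}
    (hT : ∀ n, IsOptional (T n)) (hmono : ∀ w, Monotone fun n => T n w) :
    ∀ᵐ w ∂μ, (⨆ n, T n w) < ∞ → Filter.Tendsto (fun n => coord (T n w).toNNReal w) Filter.atTop
      (𝓝 (coord (⨆ n, T n w).toNNReal w)) := by
  let r : ℕ → ℝ≥0 := fun k => 1 / (k + 1)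
  have hr0 : Filter.Tendsto r Filter.atTop (𝓝 0) := tendsto_one_div_add_atTop_nhds_zero_nat
  have hrpos : ∀ k, 0 < r k := fun k => by positivity
  let φ : ℝ → ℝ≥0∞ := fun x => ENNReal.ofReal (min 1 |x|)
  have hφc : Continuous φ :=
    ENNReal.continuous_ofReal.comp (continuous_const.min continuous_abs)
  have hφ1 : ∀ x, φ x ≤ 1 := fun x => by
    simp [φ]
  let f : ℕ → ℕ → CadlagPath → ℝ≥0∞ := fun k n =>
    {w | T n w < ∞}.indicator fun w => φ (coord (r k) (shift (T n w).toNNReal w))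
  have hA : ∀ n, MeasurableSet {w | T n w < ∞} := fun n => (hT n).measurable measurableSet_Iio
  have hf : ∀ k n, Measurable (f k n) := fun k n =>
    (hφc.measurable.comp ((measurable_coord _).comp (measurable_shift_comp
      (hT n).measurable.ennreal_toNNReal measurable_id))).indicator (hA n)
  have hfint : ∀ k n, ∫⁻ w, f k n w ∂μ ≤ ∫⁻ w, φ (coord (r k) w) ∂μ := fun k n => by
    have key := strongMarkov h (hT n) (F := fun _ _ w' => φ (coord (r k) w'))
      (hφc.measurable.comp ((measurable_coord _).comp measurable_snd))
    simp only [f]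
    rw [lintegral_indicator (hA n), key, lintegral_const, Measure.restrict_apply_univ]
    exact mul_le_of_le_one_right (zero_le) prob_le_one
  have hlim : Filter.Tendsto (fun k => ∫⁻ w, φ (coord (r k) w) ∂μ) Filter.atTop (𝓝 0) := by
    have : ∫⁻ w, φ (coord 0 w) ∂μ = 0 := by simp [coord_zero, φ]
    rw [← this]
    refine tendsto_lintegral_of_dominated_convergence (fun _ => 1)
      (fun k => hφc.measurable.comp (measurable_coord _)) (fun k => ae_of_all _ fun w => hφ1 _)
      (by simp) (ae_of_all _ fun w => ?_)
    exact (hφc.tendsto _).comp (tendsto_coord_of_ge hr0 fun n => zero_le)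
  -- Fatou's lemma, twice.
  have hzero : ∫⁻ w, Filter.liminf (fun k => Filter.liminf (fun n => f k n w) Filter.atTop)
      Filter.atTop ∂μ = 0 := by
    refine le_antisymm ?_ (zero_le)
    calc _ ≤ Filter.liminf (fun k => ∫⁻ w, Filter.liminf (fun n => f k n w) Filter.atTop ∂μ)
          Filter.atTop := lintegral_liminf_le fun k => Measurable.liminf (hf k)
      _ ≤ Filter.liminf (fun k => ∫⁻ w, φ (coord (r k) w) ∂μ) Filter.atTop := by
        refine Filter.liminf_le_liminf (Filter.Eventually.of_forall fun k => ?_)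
        refine (lintegral_liminf_le (hf k)).trans ?_
        refine (Filter.liminf_le_liminf (Filter.Eventually.of_forall (hfint k))).trans ?_
        simp
      _ = 0 := hlim.liminf_eq
  rw [lintegral_eq_zero_iff (Measurable.liminf fun k => Measurable.liminf (hf k))] at hzero
  filter_upwards [hzero] with w hw hfin
  set τ := ⨆ n, T n w with hτ
  have hTfin : ∀ n, T n w < ∞ := fun n => (le_iSup (fun n => T n w) n).trans_lt hfin
  have hTle : ∀ n, (T n w).toNNReal ≤ τ.toNNReal := fun n =>
    ENNReal.toNNReal_mono hfin.ne (le_iSup (fun n => T n w) n)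
  have hTlim : Filter.Tendsto (fun n => (T n w).toNNReal) Filter.atTop (𝓝 τ.toNNReal) :=
    (ENNReal.tendsto_toNNReal hfin.ne).comp (tendsto_atTop_iSup (hmono w))
  -- The limit exists pathwise: either `T n` reaches its limit, or it increases strictly to it and
  -- the left limit of the path applies.
  obtain ⟨L, hL⟩ : ∃ L, Filter.Tendsto (fun n => coord (T n w).toNNReal w) Filter.atTop (𝓝 L) := by
    by_cases hex : ∃ m, (T m w).toNNReal = τ.toNNReal
    · obtain ⟨m, hm⟩ := hex
      refine ⟨coord τ.toNNReal w, tendsto_const_nhds.congr' ?_⟩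
      filter_upwards [Filter.eventually_ge_atTop m] with n hn
      congr 1
      refine le_antisymm ?_ (hTle n)
      rw [← hm]
      exact ENNReal.toNNReal_mono (hTfin n).ne (hmono w hn)
    · push Not at hex
      obtain ⟨l, hl⟩ := coord_leftLim w τ.toNNReal
      refine ⟨l, hl.comp (tendsto_nhdsWithin_of_tendsto_nhds_of_eventually_within _ hTlim
        (Filter.Eventually.of_forall fun n => lt_of_le_of_ne (hTle n) (hex n)))⟩
  by_contra hne
  have hd : 0 < |coord τ.toNNReal w - L| := by
    refine abs_pos.2 fun h0 => hne ?_
    rw [sub_eq_zero.1 h0]; exact hL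
  set d := |coord τ.toNNReal w - L| with hdd
  -- A jump of size `d` at `τ` shows in the increment over `[T n, T n + r k]`, by right-continuity.
  have hlow : ∀ᶠ k in Filter.atTop, ∀ᶠ n in Filter.atTop, ENNReal.ofReal (min 1 (d / 2)) ≤ f k n w := by
    have hball := (Metric.continuousWithinAt_iff.1 (coord_rightCont w τ.toNNReal)) (d / 4)
      (by positivity)
    obtain ⟨δ, hδ, hball⟩ := hball
    have h1 : ∀ᶠ k in Filter.atTop, (r k : ℝ) < δ :=
      ((NNReal.continuous_coe.tendsto 0).comp hr0).eventually (gt_mem_nhds (by simpa using hδ))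
    filter_upwards [h1] with k hk
    have h2 : ∀ᶠ n in Filter.atTop, τ.toNNReal < (T n w).toNNReal + r k :=
      (hTlim.add_const (r k)).eventually (lt_mem_nhds (lt_add_of_pos_right _ (hrpos k)))
    have h3 : ∀ᶠ n in Filter.atTop, |coord (T n w).toNNReal w - L| < d / 4 :=
      (Metric.tendsto_nhds.1 hL) (d / 4) (by positivity)
    filter_upwards [h2, h3] with n hn2 hn3
    have h4 : |coord ((T n w).toNNReal + r k) w - coord τ.toNNReal w| < d / 4 := by
      refine hball hn2.le ?_
      have hn2' : (τ.toNNReal : ℝ) ≤ (((T n w).toNNReal + r k : ℝ≥0) : ℝ) := by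
        exact_mod_cast hn2.le
      rw [NNReal.dist_eq, abs_of_nonneg (sub_nonneg.2 hn2')]
      have : ((T n w).toNNReal : ℝ) ≤ τ.toNNReal := by exact_mod_cast hTle n
      rw [NNReal.coe_add]
      linarith
    simp only [f]
    rw [Set.indicator_of_mem (show w ∈ {w | T n w < ∞} from hTfin n)]
    refine ENNReal.ofReal_le_ofReal (min_le_min le_rfl ?_)
    rw [coord_shift]
    have h5 : coord τ.toNNReal w - L = (coord ((T n w).toNNReal + r k) w - coord (T n w).toNNReal w)
      - (coord ((T n w).toNNReal + r k) w - coord τ.toNNReal w) +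
        (coord (T n w).toNNReal w - L) := by ring
    have h6 := abs_add_le ((coord ((T n w).toNNReal + r k) w - coord (T n w).toNNReal w)
      - (coord ((T n w).toNNReal + r k) w - coord τ.toNNReal w)) (coord (T n w).toNNReal w - L)
    have h7 := abs_sub (coord ((T n w).toNNReal + r k) w - coord (T n w).toNNReal w)
      (coord ((T n w).toNNReal + r k) w - coord τ.toNNReal w)
    rw [← h5] at h6
    linarith
  have : ENNReal.ofReal (min 1 (d / 2)) ≤ 0 := by
    refine le_trans ?_ hw.le
    exact Filter.le_liminf_of_le (by isBoundedDefault) (hlow.mono fun k hk =>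
      Filter.le_liminf_of_le (by isBoundedDefault) hk)
  have h8 : 0 < min 1 (d / 2) := by positivity
  simp only [nonpos_iff_eq_zero, ENNReal.ofReal_eq_zero] at this
  linarith

end QuasiLeft

/-! ### Hitting times of closed sets -/

/-- The contact time of `z + w` with the closed set `F`: the limit of the hitting times of its
neighbourhoods of radius `1/(n+1)`. It is measurable and, almost surely, the hitting time of `F`;
the hitting time itself need not be measurable. -/
def contact (F : Set ℝ) (z : ℝ) (w : CadlagPath) : ℝ≥0∞ :=
  ⨆ n : ℕ, firstHit (Metric.thickening (1 / ((n : ℝ) + 1)) F) z w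

lemma measurable_contact_comp (F : Set ℝ) {α : Type*} [MeasurableSpace α]
    {f : α → ℝ} {g : α → CadlagPath} (hf : Measurable f) (hg : Measurable g) :
    Measurable fun a => contact F (f a) (g a) :=
  Measurable.iSup fun _ => measurable_firstHit_comp Metric.isOpen_thickening hf hg

lemma isOptional_contact (F : Set ℝ) (z : ℝ) : IsOptional (contact F z) :=
  IsOptional.iSup fun _ => isOptional_firstHit Metric.isOpen_thickening z

lemma contact_le_firstHit (F : Set ℝ) (z : ℝ) (w : CadlagPath) :
    contact F z w ≤ firstHit F z w :=
  iSup_le fun _ => firstTime_anti fun _ ht =>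
    Metric.self_subset_thickening (by positivity) F ht

lemma contact_le_of_mem {F : Set ℝ} {z : ℝ} {w : CadlagPath} {t : ℝ≥0} (h : z + coord t w ∈ F) :
    contact F z w ≤ t :=
  (contact_le_firstHit F z w).trans (firstTime_le h)

lemma contact_eq_firstHit {F : Set ℝ} {z : ℝ} {w : CadlagPath}
    (h : contact F z w < ∞ → z + coord (contact F z w).toNNReal w ∈ F) :
    contact F z w = firstHit F z w := by
  refine le_antisymm (contact_le_firstHit F z w) ?_
  rcases eq_or_ne (contact F z w) ∞ with ht | ht
  · rw [ht]; exact le_top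
  · refine (firstTime_le (h ht.lt_top)).trans ?_
    rw [ENNReal.coe_toNNReal ht]

section

variable {μ : Measure CadlagPath} [IsProbabilityMeasure μ]

lemma ae_contact_mem (h : IsLevyProcess μ coord) {F : Set ℝ} (hF : IsClosed F) (z : ℝ) :
    ∀ᵐ w ∂μ, contact F z w < ∞ → z + coord (contact F z w).toNNReal w ∈ F := by
  have hanti : ∀ {m n : ℕ}, m ≤ n → 1 / ((n : ℝ) + 1) ≤ 1 / ((m : ℝ) + 1) := fun hmn => by gcongr
  filter_upwards [quasiLeftContinuous h
    (T := fun n => firstHit (Metric.thickening (1 / ((n : ℝ) + 1)) F) z)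
    (fun n => isOptional_firstHit Metric.isOpen_thickening z)
    (fun w m n hmn => firstTime_anti fun _ ht => Metric.thickening_mono (hanti hmn) F ht)]
    with w hw hfin
  have hlim := (hw hfin).const_add z
  suffices hmem : z + coord (contact F z w).toNNReal w ∈ ⋂ δ, ⋂ (_ : 0 < δ),
      Metric.cthickening δ F by
    rwa [← Metric.closure_eq_iInter_cthickening, hF.closure_eq] at hmem
  refine Set.mem_iInter₂.2 fun δ hδ => ?_
  obtain ⟨m, hm⟩ := exists_nat_one_div_lt hδ
  refine Metric.isClosed_cthickening.mem_of_tendsto hlim ?_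
  filter_upwards [Filter.eventually_ge_atTop m] with n hn
  have hTn : firstHit (Metric.thickening (1 / ((n : ℝ) + 1)) F) z w < ∞ :=
    (le_iSup (fun n : ℕ => firstHit (Metric.thickening (1 / ((n : ℝ) + 1)) F) z w) n).trans_lt hfin
  exact Metric.cthickening_mono ((hanti hn).trans hm.le) F
    (Metric.closure_thickening_subset_cthickening _ _ (firstHit_mem_closure hTn))

end

/-! ### Entry times -/

/-- The first time `t > 0` at which `z + w` is in `F`. -/
def returnTime (F : Set ℝ) (z : ℝ) (w : CadlagPath) : ℝ≥0∞ :=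
  firstTime {t | 0 < t ∧ z + coord t w ∈ F}

/-- A measurable version of `returnTime`, which restarts at the times `1/(k+1)` and replaces
hitting times by contact times. -/
def contactReturn (F : Set ℝ) (z : ℝ) (w : CadlagPath) : ℝ≥0∞ :=
  ⨅ k : ℕ, ((1 / ((k : ℝ≥0) + 1) : ℝ≥0) : ℝ≥0∞) +
    contact F (z + coord (1 / ((k : ℝ≥0) + 1)) w) (shift (1 / ((k : ℝ≥0) + 1)) w)

lemma measurable_contactReturn_comp (F : Set ℝ) {α : Type*} [MeasurableSpace α]
    {f : α → ℝ} {g : α → CadlagPath} (hf : Measurable f) (hg : Measurable g) :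
    Measurable fun a => contactReturn F (f a) (g a) :=
  Measurable.iInf fun _ => (measurable_contact_comp F
    (hf.add ((measurable_coord _).comp hg)) ((measurable_shift _).comp hg)).const_add _

/-- The pairs of a starting point and a path for which the path is outside `F` at its contact time
with `F`. -/
def contactFails (F : Set ℝ) : Set (ℝ × CadlagPath) :=
  {p | contact F p.1 p.2 < ∞ ∧ p.1 + coord (contact F p.1 p.2).toNNReal p.2 ∉ F}

/-- The pairs of a starting point and a path for which contact fails after a restart at some
time `1/(k+1)`. -/
def returnFails (F : Set ℝ) : Set (ℝ × CadlagPath) :=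
  ⋃ k : ℕ, (fun p : ℝ × CadlagPath => (p.1 + coord (1 / ((k : ℝ≥0) + 1)) p.2,
    shift (1 / ((k : ℝ≥0) + 1)) p.2)) ⁻¹' contactFails F

lemma measurableSet_contactFails {F : Set ℝ} (hF : IsClosed F) :
    MeasurableSet (contactFails F) := by
  have hc : Measurable fun p : ℝ × CadlagPath => contact F p.1 p.2 :=
    measurable_contact_comp F measurable_fst measurable_snd
  refine (hc measurableSet_Iio).inter ?_
  exact (measurable_fst.add (measurable_coord_comp hc.ennreal_toNNReal measurable_snd))
    hF.measurableSet.compl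

lemma measurableSet_returnFails {F : Set ℝ} (hF : IsClosed F) :
    MeasurableSet (returnFails F) :=
  MeasurableSet.iUnion fun _ => measurableSet_preimage
    ((measurable_fst.add ((measurable_coord _).comp measurable_snd)).prodMk
      ((measurable_shift _).comp measurable_snd)) (measurableSet_contactFails hF)

lemma returnTime_eq_iInf (F : Set ℝ) (z : ℝ) (w : CadlagPath) :
    returnTime F z w = ⨅ k : ℕ, ((1 / ((k : ℝ≥0) + 1) : ℝ≥0) : ℝ≥0∞) +
      firstHit F (z + coord (1 / ((k : ℝ≥0) + 1)) w) (shift (1 / ((k : ℝ≥0) + 1)) w) := by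
  have hk : ∀ k : ℕ, ((1 / ((k : ℝ≥0) + 1) : ℝ≥0) : ℝ≥0∞) +
      firstHit F (z + coord (1 / ((k : ℝ≥0) + 1)) w) (shift (1 / ((k : ℝ≥0) + 1)) w) =
      firstTime {t | 1 / ((k : ℝ≥0) + 1) ≤ t ∧ z + coord t w ∈ F} := fun k => by
    rw [firstTime_eq_add (S := {t | 1 / ((k : ℝ≥0) + 1) ≤ t ∧ z + coord t w ∈ F})
      (1 / ((k : ℝ≥0) + 1)) fun t ht => ht.1, firstHit]
    congr 2
    ext t
    simp only [Set.mem_ofPred_eq, coord_shift, le_add_iff_nonneg_right, zero_le, true_and,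
      add_add_sub_cancel]
  simp_rw [hk]
  refine le_antisymm (le_iInf fun k => firstTime_anti fun t ht => ⟨?_, ht.2⟩)
    (le_firstTime fun t ht => ?_)
  · exact lt_of_lt_of_le (by positivity) ht.1
  · obtain ⟨k, hk⟩ : ∃ k : ℕ, 1 / ((k : ℝ≥0) + 1) < t := exists_nat_one_div_lt ht.1
    exact (iInf_le _ k).trans (firstTime_le ⟨hk.le, ht.2⟩)

lemma returnTime_eq_contactReturn {F : Set ℝ} {z : ℝ} {w : CadlagPath}
    (h : (z, w) ∉ returnFails F) : returnTime F z w = contactReturn F z w := by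
  rw [returnTime_eq_iInf, contactReturn]
  congr 1
  funext k
  rw [contact_eq_firstHit]
  intro hlt
  by_contra hmem
  exact h (Set.mem_iUnion.2 ⟨k, hlt, hmem⟩)

lemma firstTime_zero_of_mem {S : Set ℝ≥0} (h : (0 : ℝ≥0) ∈ S) : firstTime S = 0 :=
  le_antisymm (by simpa using firstTime_le h) (zero_le)

/-- The exit time is a hitting time of an open set, whatever the starting point. -/
lemma exitTime_eq_firstHit (B y : ℝ) (w : CadlagPath) :
    exitTime coord B y w = firstHit (Set.Icc 0 B)ᶜ y w := by
  rw [exitTime, firstHit]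
  split_ifs with h
  · rfl
  · refine (firstTime_zero_of_mem ?_).symm
    simpa [coord_zero] using h

lemma isOpen_compl_Icc (B : ℝ) : IsOpen (Set.Icc 0 B)ᶜ := isClosed_Icc.isOpen_compl

lemma isOptional_exitTime (B y : ℝ) : IsOptional (exitTime coord B y) := by
  rw [show exitTime coord B y = firstHit (Set.Icc 0 B)ᶜ y from
    funext (exitTime_eq_firstHit B y)]
  exact isOptional_firstHit (isOpen_compl_Icc B) y

/-- At the exit time the path is on or beyond one of the two boundaries. -/
lemma exitPos_mem {B y : ℝ} {w : CadlagPath} (h : exitTime coord B y w < ∞) :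
    exitPos coord B y w ≤ 0 ∨ B ≤ exitPos coord B y w := by
  have hmem := firstHit_mem_closure (exitTime_eq_firstHit B y w ▸ h)
  rw [← exitTime_eq_firstHit] at hmem
  have hsub : closure (Set.Icc 0 B)ᶜ ⊆ Set.Iic 0 ∪ Set.Ici B := by
    refine closure_minimal (fun x hx => ?_) (isClosed_Iic.union isClosed_Ici)
    simp only [Set.mem_compl_iff, Set.mem_Icc, not_and_or, not_le] at hx
    exact hx.imp le_of_lt le_of_lt
  exact hsub hmem

/-- A path restarted at its exit time exits at once. -/
lemma exitTime_shift {B y : ℝ} {w : CadlagPath} (h : exitTime coord B y w < ∞) :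
    exitTime coord B (exitPos coord B y w) (shift (exitTime coord B y w).toNNReal w) = 0 := by
  have hS : exitTime coord B y w = firstTime {t | y + coord t w ∈ (Set.Icc 0 B)ᶜ} :=
    exitTime_eq_firstHit B y w
  set χ := (exitTime coord B y w).toNNReal with hχ
  have hχ' : (χ : ℝ≥0∞) = exitTime coord B y w := ENNReal.coe_toNNReal h.ne
  have key := firstTime_eq_add (S := {t | y + coord t w ∈ (Set.Icc 0 B)ᶜ}) χ fun t ht => by
    rw [← ENNReal.coe_le_coe, hχ', hS]
    exact firstTime_le ht
  rw [← hS, ← hχ'] at key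
  have h0 : firstTime {t | χ + t ∈ {t | y + coord t w ∈ (Set.Icc 0 B)ᶜ}} = 0 := by
    have : (χ : ℝ≥0∞) + 0 = χ + firstTime {t | χ + t ∈ {t | y + coord t w ∈ (Set.Icc 0 B)ᶜ}} := by
      rw [add_zero]; exact key
    exact ((ENNReal.add_right_inj ENNReal.coe_ne_top).1 this).symm
  rw [exitTime_eq_firstHit, firstHit, ← h0]
  congr 1
  ext t
  simp [exitPos, coord_shift, ← hχ]

/-- Decomposition of the entry time at the exit time. -/
lemma entryTime_eq {B y : ℝ} {w : CadlagPath} (h : exitTime coord B y w < ∞) :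
    entryTime coord B y w = exitTime coord B y w +
      returnTime (Set.Icc 0 B) (exitPos coord B y w) (shift (exitTime coord B y w).toNNReal w) := by
  set χ := (exitTime coord B y w).toNNReal with hχ
  have hχ' : exitTime coord B y w = (χ : ℝ≥0∞) := (ENNReal.coe_toNNReal h.ne).symm
  rw [entryTime, returnTime, firstTime_eq_add χ, hχ']
  · congr 2
    ext t
    simp only [Set.mem_ofPred_eq, exitPos, coord_shift, ← hχ]
    rw [ENNReal.coe_lt_coe]
    simp
  · intro t ht
    have := ht.1
    rw [hχ', ENNReal.coe_lt_coe] at this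
    exact this.le

lemma entryTime_eq_top {B y : ℝ} {w : CadlagPath} (h : exitTime coord B y w = ∞) :
    entryTime coord B y w = ∞ := by
  refine top_le_iff.1 (le_firstTime fun t ht => ?_)
  have := ht.1
  simp [h] at this

lemma entryTime_eq_returnTime {B y : ℝ} {w : CadlagPath} (h : exitTime coord B y w = 0) :
    entryTime coord B y w = returnTime (Set.Icc 0 B) y w := by
  simp [entryTime, returnTime, h]

/-- The entry time starts afresh at the exit time. -/
lemma entryTime_eq_add_entryTime {B y : ℝ} {w : CadlagPath} (h : exitTime coord B y w < ∞) :
    entryTime coord B y w = exitTime coord B y w +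
      entryTime coord B (exitPos coord B y w) (shift (exitTime coord B y w).toNNReal w) := by
  rw [entryTime_eq h, entryTime_eq_returnTime (exitTime_shift h)]

/-- If the entry is that of the path restarted at `τ`, so is the entry position. -/
lemma entryPos_eq_of_entryTime_eq {B y : ℝ} {w : CadlagPath} {τ : ℝ≥0}
    (h : entryTime coord B y w = τ + entryTime coord B (y + coord τ w) (shift τ w))
    (hfin : entryTime coord B (y + coord τ w) (shift τ w) ≠ ∞) :
    entryPos coord B y w = entryPos coord B (y + coord τ w) (shift τ w) := by
  rw [entryPos, entryPos, h, ENNReal.toNNReal_add ENNReal.coe_ne_top hfin, ENNReal.toNNReal_coe,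
    coord_shift]
  ring

/-- The position at the first entry lies in the interval. -/
lemma entryPos_mem {B y : ℝ} {w : CadlagPath} (h : entryTime coord B y w < ∞) :
    entryPos coord B y w ∈ Set.Icc 0 B := by
  obtain ⟨u, hu, hge, hlim⟩ := exists_seq_firstTime h
  exact isClosed_Icc.mem_of_tendsto ((tendsto_coord_of_ge hlim hge).const_add y)
    (Filter.Eventually.of_forall fun n => (hu n).2)

/-- A measurable version of the entry time. -/
def entryContact (B y : ℝ) (w : CadlagPath) : ℝ≥0∞ :=
  exitTime coord B y w + if exitTime coord B y w = ∞ then 0 else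
    contactReturn (Set.Icc 0 B) (exitPos coord B y w) (shift (exitTime coord B y w).toNNReal w)

/-- The pairs of a starting point and a path for which `entryContact` may differ from the entry
time. -/
def entryFails (B : ℝ) : Set (ℝ × CadlagPath) :=
  {p | exitTime coord B p.1 p.2 < ∞ ∧ (exitPos coord B p.1 p.2,
    shift (exitTime coord B p.1 p.2).toNNReal p.2) ∈ returnFails (Set.Icc 0 B)}

lemma measurable_exitTime (B : ℝ) :
    Measurable fun p : ℝ × CadlagPath => exitTime coord B p.1 p.2 := by
  simp only [exitTime_eq_firstHit]
  exact measurable_firstHit (isOpen_compl_Icc B)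

lemma measurable_exitPos (B : ℝ) :
    Measurable fun p : ℝ × CadlagPath => exitPos coord B p.1 p.2 :=
  measurable_fst.add (measurable_coord_comp (measurable_exitTime B).ennreal_toNNReal
    measurable_snd)

lemma measurable_entryContact (B : ℝ) :
    Measurable fun p : ℝ × CadlagPath => entryContact B p.1 p.2 := by
  refine (measurable_exitTime B).add (Measurable.ite ?_ measurable_const ?_)
  · exact measurable_exitTime B (measurableSet_singleton _)
  · exact measurable_contactReturn_comp _ (measurable_exitPos B)
      (measurable_shift_comp (measurable_exitTime B).ennreal_toNNReal measurable_snd)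

lemma measurableSet_entryFails (B : ℝ) : MeasurableSet (entryFails B) := by
  refine (measurable_exitTime B measurableSet_Iio).inter ?_
  have hm : Measurable fun p : ℝ × CadlagPath => (exitPos coord B p.1 p.2,
      shift (exitTime coord B p.1 p.2).toNNReal p.2) := (measurable_exitPos B).prodMk
    (measurable_shift_comp (measurable_exitTime B).ennreal_toNNReal measurable_snd)
  exact hm (measurableSet_returnFails isClosed_Icc)

lemma entryTime_eq_entryContact {B y : ℝ} {w : CadlagPath} (h : (y, w) ∉ entryFails B) :
    entryTime coord B y w = entryContact B y w := by
  rw [entryContact]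
  split_ifs with ht
  · rw [entryTime_eq_top ht, ht, add_zero]
  · rw [entryTime_eq (Ne.lt_top ht), returnTime_eq_contactReturn]
    exact fun hmem => h ⟨Ne.lt_top ht, hmem⟩

section

variable {μ : Measure CadlagPath} [IsProbabilityMeasure μ]

lemma ae_notMem_returnFails (h : IsLevyProcess μ coord) {F : Set ℝ} (hF : IsClosed F) (z : ℝ) :
    ∀ᵐ w ∂μ, (z, w) ∉ returnFails F := by
  have hk : ∀ k : ℕ, ∀ᵐ w ∂μ, (z + coord (1 / ((k : ℝ≥0) + 1)) w,
      shift (1 / ((k : ℝ≥0) + 1)) w) ∉ contactFails F := fun k => by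
    have := ae_shift h (isOptional_const (1 / ((k : ℝ≥0) + 1))) (measurableSet_contactFails hF)
      (fun z => (ae_contact_mem h hF z).mono fun w hw hmem => hmem.2 (hw hmem.1)) z
    filter_upwards [this] with w hw
    simpa only [ENNReal.coe_lt_top, forall_const, ENNReal.toNNReal_coe] using hw
  filter_upwards [ae_all_iff.2 hk] with w hw hmem
  obtain ⟨k, hk⟩ := Set.mem_iUnion.1 hmem
  exact hw k hk

lemma ae_notMem_entryFails (h : IsLevyProcess μ coord) (B y : ℝ) :
    ∀ᵐ w ∂μ, (y, w) ∉ entryFails B := by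
  filter_upwards [ae_shift h (isOptional_exitTime B y) (measurableSet_returnFails isClosed_Icc)
    (ae_notMem_returnFails h isClosed_Icc) y] with w hw hmem
  exact hw hmem.1 hmem.2

lemma aemeasurable_entryTime (h : IsLevyProcess μ coord) (B y : ℝ) :
    AEMeasurable (entryTime coord B y) μ :=
  ⟨entryContact B y, (measurable_entryContact B).comp (measurable_const.prodMk measurable_id),
    (ae_notMem_entryFails h B y).mono fun _ hw => entryTime_eq_entryContact hw⟩

end

/-! ### Discounted laws as integrals -/

/-- `e^{-sa}`, equal to `0` for `a = ∞`. -/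
def disc (s : ℝ) (a : ℝ≥0∞) : ℝ≥0∞ :=
  if a = ∞ then 0 else ENNReal.ofReal (Real.exp (-(s * a.toReal)))

lemma disc_top (s : ℝ) : disc s ∞ = 0 := by simp [disc]

lemma measurable_disc (s : ℝ) : Measurable (disc s) :=
  Measurable.ite (measurableSet_singleton _) measurable_const
    (ENNReal.measurable_ofReal.comp (Real.measurable_exp.comp
      (measurable_id.ennreal_toReal.const_mul s).neg))

lemma disc_add (s : ℝ) (a b : ℝ≥0∞) : disc s (a + b) = disc s a * disc s b := by
  rcases eq_or_ne a ∞ with rfl | ha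
  · simp [disc_top]
  rcases eq_or_ne b ∞ with rfl | hb
  · simp [disc_top]
  rw [disc, disc, disc, if_neg ha, if_neg hb, if_neg (ENNReal.add_ne_top.2 ⟨ha, hb⟩),
    ENNReal.toReal_add ha hb, ← ENNReal.ofReal_mul (Real.exp_nonneg _), ← Real.exp_add]
  congr 2
  ring

lemma disc_le_one {s : ℝ} (hs : 0 ≤ s) (a : ℝ≥0∞) : disc s a ≤ 1 := by
  rw [disc]
  split_ifs
  · exact zero_le
  · rw [ENNReal.ofReal_le_one, Real.exp_le_one_iff]
    have := mul_nonneg hs (a.toReal_nonneg)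
    linarith

section Transform

variable {Ω : Type*} [MeasurableSpace Ω] {P : Measure Ω} {s : ℝ} {τ : Ω → ℝ≥0∞} {Y : Ω → ℝ}
  {A : Set Ω}

lemma lintegral_transform (hτ : AEMeasurable τ P) (hY : AEMeasurable Y P) (hA : MeasurableSet A)
    {g : ℝ → ℝ≥0∞} (hg : Measurable g) :
    ∫⁻ v, g v ∂(transform P s τ Y A) = ∫⁻ ω in A, disc s (τ ω) * g (Y ω) ∂P := by
  have hd : AEMeasurable (discount s τ) (P.restrict A) :=
    ((measurable_disc s).comp_aemeasurable hτ).restrict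
  rw [transform, restrict_withDensity hA, lintegral_map' hg.aemeasurable
    (hY.restrict.mono_ac (withDensity_absolutelyContinuous _ _)),
    lintegral_withDensity_eq_lintegral_mul₀ hd (g := fun ω => g (Y ω))
      (hg.comp_aemeasurable hY.restrict)]
  rfl

lemma transform_apply (hτ : AEMeasurable τ P) (hY : AEMeasurable Y P) (hA : MeasurableSet A)
    {u : Set ℝ} (hu : MeasurableSet u) :
    transform P s τ Y A u = ∫⁻ ω in A, disc s (τ ω) * u.indicator 1 (Y ω) ∂P := by
  rw [← lintegral_transform hτ hY hA (measurable_one.indicator hu), lintegral_indicator_one hu]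

/-- A discounted law that depends on `ω` through `g ω` only is the one for the law of `g`. -/
lemma transform_comp {α : Type*} [MeasurableSpace α] {g : α → Ω} {Q : Measure α}
    (hg : Measurable g) (hτ : AEMeasurable τ (Q.map g)) (hY : AEMeasurable Y (Q.map g))
    (hA : MeasurableSet A) :
    transform Q s (fun a => τ (g a)) (fun a => Y (g a)) (g ⁻¹' A) =
      transform (Q.map g) s τ Y A := by
  ext u hu
  rw [transform_apply (τ := fun a => τ (g a)) (Y := fun a => Y (g a)) (hτ.comp_measurable hg)
      (hY.comp_measurable hg) (hg hA) hu,
    transform_apply hτ hY hA hu, Measure.restrict_map hg hA, lintegral_map' _ hg.aemeasurable]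
  rw [← Measure.restrict_map hg hA]
  exact (((measurable_disc s).comp_aemeasurable hτ).mul
    ((measurable_one.indicator hu).comp_aemeasurable hY)).restrict

end Transform

/-! ### Laws of the coordinate process -/

lemma tauUp_eq (x : ℝ) (w : CadlagPath) : tauUp coord x w = firstHit (Set.Ioi 0) (-x) w := by
  simp only [tauUp, firstHit]
  congr 1
  ext t
  simp

lemma tauDown_eq (x : ℝ) (w : CadlagPath) : tauDown coord x w = firstHit (Set.Iio 0) x w := by
  simp only [tauDown, firstHit]
  congr 1
  ext t
  simp only [Set.mem_ofPred_eq, Set.mem_Iio]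
  constructor <;> intro h <;> linarith

lemma measurable_tauUp : Measurable fun p : ℝ × CadlagPath => tauUp coord p.1 p.2 := by
  simp only [tauUp_eq]
  exact measurable_firstHit_comp isOpen_Ioi measurable_fst.neg measurable_snd

lemma measurable_tauDown : Measurable fun p : ℝ × CadlagPath => tauDown coord p.1 p.2 := by
  simp only [tauDown_eq]
  exact measurable_firstHit_comp isOpen_Iio measurable_fst measurable_snd

lemma isOptional_tauDown (x : ℝ) : IsOptional (tauDown coord x) := by
  rw [funext (tauDown_eq x)]
  exact isOptional_firstHit isOpen_Iio x

lemma measurable_overshootUp : Measurable fun p : ℝ × CadlagPath => overshootUp coord p.1 p.2 :=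
  (measurable_coord_comp measurable_tauUp.ennreal_toNNReal measurable_snd).sub measurable_fst

lemma measurable_overshootDown :
    Measurable fun p : ℝ × CadlagPath => overshootDown coord p.1 p.2 :=
  (measurable_coord_comp measurable_tauDown.ennreal_toNNReal measurable_snd).neg.sub measurable_fst

lemma measurable_section {β : Type*} [MeasurableSpace β] {f : ℝ → CadlagPath → β}
    (hf : Measurable fun p : ℝ × CadlagPath => f p.1 p.2) (y : ℝ) : Measurable (f y) :=
  hf.comp (measurable_const.prodMk measurable_id)

section

variable {μ : Measure CadlagPath}

lemma lintegral_upLaw (s x : ℝ) {g : ℝ → ℝ≥0∞} (hg : Measurable g) :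
    ∫⁻ v, g v ∂(upLaw μ coord s x) =
      ∫⁻ w, disc s (tauUp coord x w) * g (overshootUp coord x w) ∂μ := by
  rw [upLaw, lintegral_transform (measurable_section measurable_tauUp x).aemeasurable
    (measurable_section measurable_overshootUp x).aemeasurable MeasurableSet.univ hg,
    Measure.restrict_univ]

lemma lintegral_downLaw (s x : ℝ) {g : ℝ → ℝ≥0∞} (hg : Measurable g) :
    ∫⁻ v, g v ∂(downLaw μ coord s x) =
      ∫⁻ w, disc s (tauDown coord x w) * g (overshootDown coord x w) ∂μ := by
  rw [downLaw, lintegral_transform (measurable_section measurable_tauDown x).aemeasurable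
    (measurable_section measurable_overshootDown x).aemeasurable MeasurableSet.univ hg,
    Measure.restrict_univ]

lemma lintegral_downJumpLaw (B s x : ℝ) {g : ℝ → ℝ≥0∞} (hg : Measurable g) :
    ∫⁻ v, g v ∂(downJumpLaw μ coord B s x) =
      ∫⁻ w, disc s (tauDown coord x w) *
        (Set.Ioi 0).indicator g (overshootDown coord x w - B) ∂μ := by
  have hm : Measurable fun r : ℝ => r - B := measurable_id.sub_const B
  rw [downJumpLaw, ← lintegral_indicator measurableSet_Ioi,
    lintegral_map (hg.indicator measurableSet_Ioi) hm,
    lintegral_downLaw s x (g := fun r => (Set.Ioi 0).indicator g (r - B)) ((hg.indicator measurableSet_Ioi).comp hm)]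

variable [IsProbabilityMeasure μ]

lemma measurable_lintegral_path {f : ℝ → CadlagPath → ℝ≥0∞}
    (hf : Measurable fun p : ℝ × CadlagPath => f p.1 p.2) :
    Measurable fun y => ∫⁻ w, f y w ∂μ :=
  Measurable.lintegral_prod_right' (f := fun p : ℝ × CadlagPath => f p.1 p.2) hf

lemma measurable_upLaw (s : ℝ) : Measurable fun x => upLaw μ coord s x := by
  refine Measure.measurable_of_measurable_coe _ fun u hu => ?_
  simp only [← lintegral_indicator_one hu, lintegral_upLaw s _ (measurable_one.indicator hu)]
  exact measurable_lintegral_path (((measurable_disc s).comp measurable_tauUp).mul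
    ((measurable_one.indicator hu).comp measurable_overshootUp))

lemma measurable_downLaw (s : ℝ) : Measurable fun x => downLaw μ coord s x := by
  refine Measure.measurable_of_measurable_coe _ fun u hu => ?_
  simp only [← lintegral_indicator_one hu, lintegral_downLaw s _ (measurable_one.indicator hu)]
  exact measurable_lintegral_path (((measurable_disc s).comp measurable_tauDown).mul
    ((measurable_one.indicator hu).comp measurable_overshootDown))

lemma measurable_upJumpLaw (B s : ℝ) : Measurable fun x => upJumpLaw μ coord B s x := by
  refine Measure.measurable_of_measurable_coe _ fun u hu => ?_
  have : ∀ x, upJumpLaw μ coord B s x u =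
      upLaw μ coord s x ((fun r => r - B) ⁻¹' (u ∩ Set.Ioi 0)) := fun x => by
    have hm : Measurable fun r : ℝ => r - B := measurable_id.sub_const B
    rw [upJumpLaw, Measure.restrict_apply hu, Measure.map_apply hm (hu.inter measurableSet_Ioi)]
  simp only [this]
  exact (Measure.measurable_coe ((measurable_id.sub_const B) (hu.inter measurableSet_Ioi))).comp
    (measurable_upLaw s)

lemma measurable_downJumpLaw (B s : ℝ) : Measurable fun x => downJumpLaw μ coord B s x := by
  refine Measure.measurable_of_measurable_coe _ fun u hu => ?_
  have : ∀ x, downJumpLaw μ coord B s x u =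
      downLaw μ coord s x ((fun r => r - B) ⁻¹' (u ∩ Set.Ioi 0)) := fun x => by
    have hm : Measurable fun r : ℝ => r - B := measurable_id.sub_const B
    rw [downJumpLaw, Measure.restrict_apply hu, Measure.map_apply hm (hu.inter measurableSet_Ioi)]
  simp only [this]
  exact (Measure.measurable_coe ((measurable_id.sub_const B) (hu.inter measurableSet_Ioi))).comp
    (measurable_downLaw s)

/-- The discounted indicator of an entry into `u`. -/
def entryVal (B s : ℝ) (u : Set ℝ) (y : ℝ) (w : CadlagPath) : ℝ≥0∞ :=
  disc s (entryTime coord B y w) * u.indicator 1 (entryPos coord B y w)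

/-- A measurable version of `entryVal`. -/
def entryValContact (B s : ℝ) (u : Set ℝ) (y : ℝ) (w : CadlagPath) : ℝ≥0∞ :=
  disc s (entryContact B y w) * u.indicator 1 (y + coord (entryContact B y w).toNNReal w)

lemma entryVal_eq_entryValContact {B s : ℝ} {u : Set ℝ} {y : ℝ} {w : CadlagPath}
    (h : (y, w) ∉ entryFails B) : entryVal B s u y w = entryValContact B s u y w := by
  rw [entryVal, entryValContact, entryPos, entryTime_eq_entryContact h]

lemma measurable_entryValContact (B s : ℝ) {u : Set ℝ} (hu : MeasurableSet u) :
    Measurable fun p : ℝ × CadlagPath => entryValContact B s u p.1 p.2 :=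
  ((measurable_disc s).comp (measurable_entryContact B)).mul
    ((measurable_one.indicator hu).comp (measurable_fst.add (measurable_coord_comp
      (measurable_entryContact B).ennreal_toNNReal measurable_snd)))

lemma aemeasurable_entryPos (h : IsLevyProcess μ coord) (B y : ℝ) :
    AEMeasurable (entryPos coord B y) μ :=
  ⟨fun w => y + coord (entryContact B y w).toNNReal w,
    (measurable_coord_comp (measurable_section (measurable_entryContact B) y).ennreal_toNNReal
      measurable_id).const_add y,
    (ae_notMem_entryFails h B y).mono fun w hw => by
      rw [entryPos, entryTime_eq_entryContact hw]⟩

lemma entryLaw_apply (h : IsLevyProcess μ coord) (B s y : ℝ) {u : Set ℝ} (hu : MeasurableSet u) :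
    entryLaw μ coord B s y u = ∫⁻ w, entryVal B s u y w ∂μ := by
  rw [entryLaw, transform_apply (aemeasurable_entryTime h B y) (aemeasurable_entryPos h B y)
    MeasurableSet.univ hu, Measure.restrict_univ]
  rfl

lemma entryLaw_apply_contact (h : IsLevyProcess μ coord) (B s y : ℝ) {u : Set ℝ}
    (hu : MeasurableSet u) :
    entryLaw μ coord B s y u = ∫⁻ w, entryValContact B s u y w ∂μ := by
  rw [entryLaw_apply h B s y hu]
  exact lintegral_congr_ae ((ae_notMem_entryFails h B y).mono fun w hw =>
    entryVal_eq_entryValContact hw)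

lemma measurable_entryLaw_apply (h : IsLevyProcess μ coord) (B s : ℝ) {u : Set ℝ}
    (hu : MeasurableSet u) : Measurable fun y => entryLaw μ coord B s y u := by
  simp only [entryLaw_apply_contact h B s _ hu]
  exact measurable_lintegral_path (measurable_entryValContact B s hu)

/-- The strong Markov property for the entry into `[0,B]` after an optional time. -/
lemma lintegral_entryVal_shift (h : IsLevyProcess μ coord) (B s z : ℝ) {u : Set ℝ}
    (hu : MeasurableSet u) {τ : CadlagPath → ℝ≥0∞} (hτ : IsOptional τ) {g : ℝ≥0 → ℝ → ℝ≥0∞}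
    (hg : Measurable fun p : ℝ≥0 × ℝ => g p.1 p.2) :
    ∫⁻ w in {w | τ w < ∞}, g (τ w).toNNReal (coord (τ w).toNNReal w) *
        entryVal B s u (z + coord (τ w).toNNReal w) (shift (τ w).toNNReal w) ∂μ =
      ∫⁻ w in {w | τ w < ∞}, g (τ w).toNNReal (coord (τ w).toNNReal w) *
        entryLaw μ coord B s (z + coord (τ w).toNNReal w) u ∂μ := by
  have hA : MeasurableSet {w | τ w < ∞} := hτ.measurable measurableSet_Iio
  have hF : Measurable fun p : (ℝ≥0 × ℝ) × CadlagPath =>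
      g p.1.1 p.1.2 * entryValContact B s u (z + p.1.2) p.2 :=
    (hg.comp measurable_fst).mul ((measurable_entryValContact B s hu).comp
      (((measurable_snd.comp measurable_fst).const_add z).prodMk measurable_snd))
  have key := strongMarkov h hτ
    (F := fun t x w' => g t x * entryValContact B s u (z + x) w') hF
  calc _ = ∫⁻ w in {w | τ w < ∞}, g (τ w).toNNReal (coord (τ w).toNNReal w) *
        entryValContact B s u (z + coord (τ w).toNNReal w) (shift (τ w).toNNReal w) ∂μ := by
        refine setLIntegral_congr_fun_ae hA ?_
        filter_upwards [ae_shift h hτ (measurableSet_entryFails B) (ae_notMem_entryFails h B) z]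
          with w hw hlt
        rw [entryVal_eq_entryValContact (hw hlt)]
    _ = _ := by
        rw [key]
        refine setLIntegral_congr_fun hA fun w _ => ?_
        rw [lintegral_const_mul _ (measurable_section (measurable_entryValContact B s hu) _),
          entryLaw_apply_contact h B s _ hu]

/-- Entry from inside the interval: the path leaves the interval through one of the two
boundaries and is then restarted. -/
theorem entryLaw_inside (h : IsLevyProcess μ coord) {B : ℝ} (hB : 0 < B) (s y : ℝ)
    {u : Set ℝ} (hu : MeasurableSet u) :
    entryLaw μ coord B s y u =
      ∫⁻ v, entryLaw μ coord B s (v + B) u ∂(exitAboveLaw μ coord B s y) +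
      ∫⁻ v, entryLaw μ coord B s (-v) u ∂(exitBelowLaw μ coord B s y) := by
  set G : ℝ → ℝ≥0∞ := fun z => entryLaw μ coord B s z u with hG
  have hGm : Measurable G := measurable_entryLaw_apply h B s hu
  have hpos : Measurable (exitPos coord B y) := measurable_section (measurable_exitPos B) y
  have htime : Measurable (exitTime coord B y) := measurable_section (measurable_exitTime B) y
  have hab : MeasurableSet (exitAbove coord B y) := hpos measurableSet_Ici
  have hbe : MeasurableSet (exitBelow coord B y) := hpos measurableSet_Iic
  have hA : MeasurableSet {w | exitTime coord B y w < ∞} := htime measurableSet_Iio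
  have hdisj : Disjoint (exitAbove coord B y) (exitBelow coord B y) := by
    refine Set.disjoint_left.2 fun w h1 h2 => ?_
    have h1' : B ≤ exitPos coord B y w := h1
    have h2' : exitPos coord B y w ≤ 0 := h2
    linarith
  have e1 : ∫⁻ v, entryLaw μ coord B s (v + B) u ∂(exitAboveLaw μ coord B s y) =
      ∫⁻ w in exitAbove coord B y, disc s (exitTime coord B y w) * G (exitPos coord B y w) ∂μ := by
    rw [exitAboveLaw, lintegral_transform htime.aemeasurable (hpos.sub_const B).aemeasurable hab
      (g := fun v => G (v + B)) (hGm.comp (measurable_id.add_const B))]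
    simp only [sub_add_cancel]
  have e2 : ∫⁻ v, entryLaw μ coord B s (-v) u ∂(exitBelowLaw μ coord B s y) =
      ∫⁻ w in exitBelow coord B y, disc s (exitTime coord B y w) * G (exitPos coord B y w) ∂μ := by
    rw [exitBelowLaw, lintegral_transform (Y := fun w => -exitPos coord B y w)
      htime.aemeasurable hpos.neg.aemeasurable hbe (g := fun v => G (-v)) (hGm.comp measurable_neg)]
    simp only [neg_neg]
  rw [e1, e2, ← lintegral_union hbe hdisj, entryLaw_apply h B s y hu]
  have key := lintegral_entryVal_shift h B s y hu (isOptional_exitTime B y)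
    (g := fun t _ => disc s t)
    ((measurable_disc s).comp (measurable_coe_nnreal_ennreal.comp measurable_fst))
  have hL : ∫⁻ w, entryVal B s u y w ∂μ = ∫⁻ w in {w | exitTime coord B y w < ∞},
      disc s (exitTime coord B y w).toNNReal * entryVal B s u
        (y + coord (exitTime coord B y w).toNNReal w) (shift (exitTime coord B y w).toNNReal w)
        ∂μ := by
    rw [← lintegral_indicator hA]
    refine lintegral_congr fun w => ?_
    by_cases hw : exitTime coord B y w < ∞
    · rw [Set.indicator_of_mem (show w ∈ {w | exitTime coord B y w < ∞} from hw)]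
      have h1 := entryTime_eq_add_entryTime hw
      have hχ : ((exitTime coord B y w).toNNReal : ℝ≥0∞) = exitTime coord B y w :=
        ENNReal.coe_toNNReal hw.ne
      rw [exitPos, ← hχ] at h1
      simp only [ENNReal.toNNReal_coe] at h1
      rw [entryVal, entryVal, h1, disc_add, mul_assoc]
      by_cases hfin : entryTime coord B (y + coord (exitTime coord B y w).toNNReal w)
          (shift (exitTime coord B y w).toNNReal w) = ∞
      · simp [hfin, disc_top]
      · rw [entryPos_eq_of_entryTime_eq h1 hfin]
    · rw [Set.indicator_of_notMem (show w ∉ {w | exitTime coord B y w < ∞} from hw), entryVal,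
        entryTime_eq_top (not_lt_top_iff.1 hw), disc_top, zero_mul]
  rw [hL, key, ← lintegral_indicator hA, ← lintegral_indicator (hab.union hbe)]
  refine lintegral_congr fun w => ?_
  by_cases hw : exitTime coord B y w < ∞
  · rw [Set.indicator_of_mem (show w ∈ {w | exitTime coord B y w < ∞} from hw),
      Set.indicator_of_mem (show w ∈ exitAbove coord B y ∪ exitBelow coord B y from
        (exitPos_mem hw).symm), ENNReal.coe_toNNReal hw.ne]
    rfl
  · rw [Set.indicator_of_notMem (show w ∉ {w | exitTime coord B y w < ∞} from hw)]
    by_cases hm : w ∈ exitAbove coord B y ∪ exitBelow coord B y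
    · rw [Set.indicator_of_mem hm, not_lt_top_iff.1 hw, disc_top, zero_mul]
    · rw [Set.indicator_of_notMem hm]

end

/-! ### Occupation times -/

/-- Lebesgue measure on the time axis `[0, ∞)`. -/
def timeMeasure : Measure ℝ≥0 := ((volume : Measure ℝ).restrict (Set.Ici 0)).map Real.toNNReal

instance : SFinite timeMeasure := by unfold timeMeasure; infer_instance

lemma timeMeasure_ae {p : ℝ≥0 → Prop} (hp : MeasurableSet {t | p t})
    (h : ∀ᵐ t ∂((volume : Measure ℝ).restrict (Set.Ici 0)), p t.toNNReal) :
    ∀ᵐ t ∂timeMeasure, p t :=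
  (ae_map_iff measurable_real_toNNReal.aemeasurable hp).2 h

lemma lintegral_timeMeasure {f : ℝ≥0 → ℝ≥0∞} (hf : Measurable f) :
    ∫⁻ t, f t ∂timeMeasure = ∫⁻ t in Set.Ici (0 : ℝ), f t.toNNReal := by
  rw [timeMeasure, lintegral_map hf measurable_real_toNNReal]

/-- Translation of the time axis. -/
lemma lintegral_timeMeasure_add (r : ℝ≥0) {f : ℝ≥0 → ℝ≥0∞} (hf : Measurable f) :
    ∫⁻ t, f (r + t) ∂timeMeasure = ∫⁻ t in Set.Ici r, f t ∂timeMeasure := by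
  rw [← lintegral_indicator measurableSet_Ici,
    lintegral_timeMeasure (f := fun t => f (r + t)) (hf.comp (measurable_id.const_add r)),
    lintegral_timeMeasure (hf.indicator measurableSet_Ici), ← lintegral_indicator measurableSet_Ici,
    ← lintegral_indicator measurableSet_Ici,
    ← lintegral_add_right_eq_self
      (fun t : ℝ => (Set.Ici 0).indicator (fun t => (Set.Ici r).indicator f t.toNNReal) t) (r : ℝ)]
  refine lintegral_congr fun t => ?_
  by_cases ht : 0 ≤ t
  · have h1 : (0 : ℝ) ≤ t + r := add_nonneg ht r.2
    have h2 : (t + r).toNNReal = r + t.toNNReal := by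
      rw [Real.toNNReal_add ht (NNReal.coe_nonneg r), Real.toNNReal_coe, add_comm]
    rw [Set.indicator_of_mem (show t ∈ Set.Ici 0 from ht),
      Set.indicator_of_mem (show t + r ∈ Set.Ici 0 from h1), h2,
      Set.indicator_of_mem (Set.mem_Ici.2 (le_self_add : r ≤ r + t.toNNReal))]
  · rw [Set.indicator_of_notMem (show t ∉ Set.Ici 0 from ht)]
    by_cases h1 : (0 : ℝ) ≤ t + r
    · rw [Set.indicator_of_mem (show t + r ∈ Set.Ici 0 from h1), Set.indicator_of_notMem]
      simp only [Set.mem_Ici, not_le]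
      rw [← NNReal.coe_lt_coe, Real.coe_toNNReal _ h1]
      linarith
    · rw [Set.indicator_of_notMem (show t + r ∉ Set.Ici 0 from h1)]

lemma timeMeasure_Iio_pos {ε : ℝ≥0} (hε : 0 < ε) : timeMeasure (Set.Iio ε) ≠ 0 := by
  rw [timeMeasure, Measure.map_apply measurable_real_toNNReal measurableSet_Iio,
    Measure.restrict_apply (measurable_real_toNNReal measurableSet_Iio)]
  refine ne_of_gt (lt_of_lt_of_le ?_ (measure_mono (s := Set.Ioo (0 : ℝ) ε) ?_))
  · rw [Real.volume_Ioo]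
    simpa using hε
  · intro t ht
    refine ⟨?_, ht.1.le⟩
    rw [Set.mem_preimage, Set.mem_Iio, ← NNReal.coe_lt_coe, Real.coe_toNNReal _ ht.1.le]
    exact ht.2

lemma measurableSet_coord_eq (z : ℝ) (w : CadlagPath) :
    MeasurableSet {t : ℝ≥0 | z + coord t w = 0} :=
  (measurable_coord_comp measurable_id measurable_const).const_add z (measurableSet_singleton 0)

/-- The time that `z + w` spends at `0`. -/
def occ (z : ℝ) (w : CadlagPath) : ℝ≥0∞ := timeMeasure {t | z + coord t w = 0}

lemma measurableSet_coord_eq_joint :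
    MeasurableSet {p : (ℝ × CadlagPath) × ℝ≥0 | p.1.1 + coord p.2 p.1.2 = 0} := by
  have hm : Measurable fun p : (ℝ × CadlagPath) × ℝ≥0 => p.1.1 + coord p.2 p.1.2 :=
    (measurable_fst.comp measurable_fst).add
      (measurable_coord_comp measurable_snd (measurable_snd.comp measurable_fst))
  exact hm (measurableSet_singleton 0)

lemma measurable_occ : Measurable fun p : ℝ × CadlagPath => occ p.1 p.2 :=
  measurable_measure_prodMk_left measurableSet_coord_eq_joint

/-- The time spent at `0` after time `r`. -/
lemma occ_shift (z : ℝ) (r : ℝ≥0) (w : CadlagPath) :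
    occ (z + coord r w) (shift r w) = timeMeasure ({t | z + coord t w = 0} ∩ Set.Ici r) := by
  have hm := measurableSet_coord_eq z w
  have := lintegral_timeMeasure_add r (measurable_one.indicator hm)
  rw [lintegral_indicator_one hm, Measure.restrict_apply hm] at this
  rw [← this, occ, ← lintegral_indicator_one (measurableSet_coord_eq _ _)]
  refine lintegral_congr fun t => ?_
  simp [Set.indicator, coord_shift]

lemma occ_shift_le (z : ℝ) (r : ℝ≥0) (w : CadlagPath) :
    occ (z + coord r w) (shift r w) ≤ occ z w := by
  rw [occ_shift]
  exact measure_mono Set.inter_subset_left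

/-- The mean time that the process started at `z` spends at `0`. -/
def meanOcc (μ : Measure CadlagPath) (z : ℝ) : ℝ≥0∞ := ∫⁻ w, occ z w ∂μ

/-- The pairs `(x, w)` such that `w` stays above `-x` for a while after having come arbitrarily
close to it: the passage time below `-x` is a jump of the passage time as a function of `x`. -/
def passageJump : Set (ℝ × CadlagPath) :=
  {p | ⨆ n : ℕ, tauDown coord (p.1 - 1 / ((n : ℝ) + 1)) p.2 < tauDown coord p.1 p.2}

lemma measurableSet_passageJump : MeasurableSet passageJump :=
  measurableSet_lt (Measurable.iSup fun n => by
    have := measurable_tauDown.comp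
      ((measurable_fst.sub_const (1 / ((n : ℝ) + 1))).prodMk measurable_snd)
    exact this) measurable_tauDown

lemma countable_passageJump (w : CadlagPath) : {x | (x, w) ∈ passageJump}.Countable := by
  have hmono : Monotone fun x => tauDown coord x w := fun x x' hx =>
    firstTime_anti fun t (ht : coord t w < -x') => lt_of_lt_of_le ht (neg_le_neg hx)
  refine Set.Countable.mono ?_ hmono.countable_not_continuousAt
  rintro x hx (hc : ContinuousAt (fun x => tauDown coord x w) x)
  have hlim : Filter.Tendsto (fun n : ℕ => x - 1 / ((n : ℝ) + 1)) Filter.atTop (𝓝 x) := by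
    simpa using (tendsto_one_div_add_atTop_nhds_zero_nat (𝕜 := ℝ)).const_sub x
  have hle := le_of_tendsto (hc.tendsto.comp hlim) (Filter.Eventually.of_forall fun n =>
    le_iSup (fun n : ℕ => tauDown coord (x - 1 / ((n : ℝ) + 1)) w) n)
  exact absurd hx (not_lt.2 hle)

/-- The path is at `-v` at some positive time before it first passes below `-v`. -/
def touches (v : ℝ) (w : CadlagPath) : Prop :=
  ∃ t : ℝ≥0, 0 < t ∧ coord t w = -v ∧ (t : ℝ≥0∞) < tauDown coord v w

lemma coord_ge_of_lt_tauDown {v : ℝ} {w : CadlagPath} {t : ℝ≥0}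
    (h : (t : ℝ≥0∞) < tauDown coord v w) : -v ≤ coord t w := by
  by_contra hlt
  exact absurd h (not_lt.2 (firstTime_le (not_le.1 hlt)))

/-- If a path touches `-v` at time `t`, then for its restart at any earlier time the level `-v` is
a jump of the passage time. -/
lemma mem_passageJump_of_touches {v : ℝ} {w : CadlagPath} {r t : ℝ≥0} (hrt : r ≤ t)
    (ht : coord t w = -v) (hlt : (t : ℝ≥0∞) < tauDown coord v w) :
    (v + coord r w, shift r w) ∈ passageJump := by
  obtain ⟨d, rfl⟩ := exists_add_of_le hrt
  have h1 : tauDown coord v w = r + tauDown coord (v + coord r w) (shift r w) := by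
    rw [tauDown, firstTime_eq_add r, tauDown]
    · congr 2
      ext q
      simp only [Set.mem_ofPred_eq, coord_shift]
      constructor <;> intro h <;> linarith
    · intro q hq
      have := hlt.trans_le (firstTime_le hq)
      exact le_self_add.trans (by exact_mod_cast this.le)
  have h2 : (d : ℝ≥0∞) < tauDown coord (v + coord r w) (shift r w) := by
    rw [h1, ENNReal.coe_add] at hlt
    exact (ENNReal.add_lt_add_iff_left ENNReal.coe_ne_top).1 hlt
  refine (iSup_le fun n => firstTime_le ?_).trans_lt h2
  simp only [Set.mem_ofPred_eq, coord_shift, ht]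
  have : 0 < 1 / ((n : ℝ) + 1) := by positivity
  linarith

section

variable {μ : Measure CadlagPath}

lemma meanOcc_eq_zero_iff (z : ℝ) : meanOcc μ z = 0 ↔ ∀ᵐ w ∂μ, occ z w = 0 :=
  lintegral_eq_zero_iff (measurable_section measurable_occ z)

variable [IsProbabilityMeasure μ]

lemma measurable_meanOcc : Measurable (meanOcc μ) := measurable_lintegral_path measurable_occ

lemma meanOcc_eq (z : ℝ) :
    meanOcc μ z = ∫⁻ t, μ {w | z + coord t w = 0} ∂timeMeasure := by
  have hm : MeasurableSet {p : CadlagPath × ℝ≥0 | z + coord p.2 p.1 = 0} :=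
    ((measurable_const.prodMk measurable_fst).prodMk measurable_snd
      : Measurable fun p : CadlagPath × ℝ≥0 => ((z, p.1), p.2)) measurableSet_coord_eq_joint
  have h1 := Measure.prod_apply (μ := μ) (ν := timeMeasure) hm
  rw [Measure.prod_apply_symm hm] at h1
  exact h1.symm

/-- A process that spends no time at `0` spends none there after an optional time either. -/
lemma ae_meanOcc_shift (h : IsLevyProcess μ coord) {z : ℝ} (hz : meanOcc μ z = 0)
    {τ : CadlagPath → ℝ≥0∞} (hτ : IsOptional τ) :
    ∀ᵐ w ∂μ, τ w < ∞ → meanOcc μ (z + coord (τ w).toNNReal w) = 0 := by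
  have hA : MeasurableSet {w | τ w < ∞} := hτ.measurable measurableSet_Iio
  have key := strongMarkov h hτ (F := fun _ x w' => occ (z + x) w')
    (measurable_occ.comp (((measurable_snd.comp measurable_fst).const_add z).prodMk
      measurable_snd))
  have h0 : ∫⁻ w in {w | τ w < ∞}, occ (z + coord (τ w).toNNReal w) (shift (τ w).toNNReal w) ∂μ
      = 0 := by
    refine le_antisymm ?_ (zero_le)
    calc _ ≤ ∫⁻ w in {w | τ w < ∞}, occ z w ∂μ := lintegral_mono fun w => occ_shift_le z _ w
      _ ≤ meanOcc μ z := setLIntegral_le_lintegral _ _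
      _ = 0 := hz
  rw [h0] at key
  have hm : Measurable fun w => meanOcc μ (z + coord (τ w).toNNReal w) :=
    measurable_meanOcc.comp ((measurable_coord_comp hτ.measurable.ennreal_toNNReal
      measurable_id).const_add z)
  exact (ae_restrict_iff' hA).1 ((lintegral_eq_zero_iff hm).1 key.symm)

/-- If the process started at `0` spends no time at `0`, then it spends no time at any point:
apply the strong Markov property when the point is first hit. -/
lemma meanOcc_eq_zero (h : IsLevyProcess μ coord) (h0 : meanOcc μ 0 = 0) (z : ℝ) :
    meanOcc μ z = 0 := by
  have hT : IsOptional (contact {0} z) := isOptional_contact {0} z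
  have hA : MeasurableSet {w | contact {0} z w < ∞} := hT.measurable measurableSet_Iio
  have key := strongMarkov h hT (F := fun _ _ w' => occ 0 w')
    ((measurable_section measurable_occ 0).comp measurable_snd)
  have hR : ∫⁻ w', occ 0 w' ∂μ = 0 := h0
  simp only [hR, lintegral_zero] at key
  have hm : Measurable fun w => occ 0 (shift (contact {0} z w).toNNReal w) :=
    (measurable_section measurable_occ 0).comp
      (measurable_shift_comp hT.measurable.ennreal_toNNReal measurable_id)
  rw [lintegral_eq_zero_iff hm, Filter.EventuallyEq,
    ae_restrict_iff' hA] at key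
  rw [meanOcc_eq_zero_iff]
  filter_upwards [key, ae_contact_mem h (isClosed_singleton (x := (0 : ℝ))) z] with w hw hmem
  by_cases hfin : contact {0} z w < ∞
  · have h1 : z + coord (contact {0} z w).toNNReal w = 0 := hmem hfin
    have h2 : occ 0 (shift (contact {0} z w).toNNReal w) = 0 := hw hfin
    have h3 := occ_shift z (contact {0} z w).toNNReal w
    rw [h1, h2] at h3
    rw [occ, h3]
    congr 1
    refine (Set.inter_eq_left.2 fun t ht => ?_).symm
    rw [Set.mem_Ici, ← ENNReal.coe_le_coe, ENNReal.coe_toNNReal hfin.ne]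
    exact contact_le_of_mem ht
  · have : {t : ℝ≥0 | z + coord t w = 0} = ∅ := by
      refine Set.eq_empty_of_forall_notMem fun t ht => hfin ?_
      exact (contact_le_of_mem (F := {0}) ht).trans_lt ENNReal.coe_lt_top
    rw [occ, this, measure_empty]

/-- If the process spends no time at any point, then at almost every time `r` the path after `r`
does not jump over its passage level: the jumping levels of a path form a countable set, and the
position at time `r` is independent of it. -/
lemma ae_ae_notMem_passageJump (h : IsLevyProcess μ coord) (h0 : meanOcc μ 0 = 0) (v : ℝ) :
    ∀ᵐ r ∂timeMeasure, ∀ᵐ w ∂μ, (v + coord r w, shift r w) ∉ passageJump := by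
  have hJ := measurableSet_passageJump
  let f : ℝ × CadlagPath → ℝ≥0∞ := passageJump.indicator 1
  have hf : Measurable f := measurable_one.indicator hJ
  have hmarkov : ∀ r, ∫⁻ w, f (v + coord r w, shift r w) ∂μ =
      ∫⁻ w, ∫⁻ w', f (v + coord r w, w') ∂μ ∂μ := fun r => by
    have := strongMarkov h (isOptional_const r) (F := fun _ x w' => f (v + x, w'))
      (hf.comp (((measurable_snd.comp measurable_fst).const_add v).prodMk measurable_snd))
    simpa only [ENNReal.coe_lt_top, ENNReal.toNNReal_coe, Set.ofPred_true,
      Measure.restrict_univ] using this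
  have hm3 : Measurable fun p : (ℝ≥0 × CadlagPath) × CadlagPath =>
      f (v + coord p.1.1 p.1.2, p.2) :=
    hf.comp (((measurable_coord_comp (measurable_fst.comp measurable_fst)
      (measurable_snd.comp measurable_fst)).const_add v).prodMk measurable_snd)
  -- For a fixed path `w'`, the levels in question are countably many, and the process spends no time
  -- at any of them.
  have hzero : ∀ w', ∫⁻ p : ℝ≥0 × CadlagPath, f (v + coord p.1 p.2, w') ∂(timeMeasure.prod μ)
      = 0 := fun w' => by
    have hm2 : Measurable fun p : ℝ≥0 × CadlagPath => f (v + coord p.1 p.2, w') :=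
      hf.comp (((measurable_coord_comp measurable_fst measurable_snd).const_add v).prodMk
        measurable_const)
    rw [lintegral_prod_symm' _ hm2]
    refine lintegral_eq_zero_of_ae_eq_zero ?_
    have hC := countable_passageJump w'
    have hae : ∀ᵐ w ∂μ, ∀ c ∈ {x | (x, w') ∈ passageJump}, occ (v - c) w = 0 :=
      (ae_ball_iff hC).2 fun c _ => (meanOcc_eq_zero_iff _).1 (meanOcc_eq_zero h h0 _)
    filter_upwards [hae] with w hw
    refine lintegral_eq_zero_of_ae_eq_zero ?_
    have hnull : timeMeasure (⋃ c ∈ {x | (x, w') ∈ passageJump}, {t | v - c + coord t w = 0}) = 0 :=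
      (measure_biUnion_null_iff hC).2 hw
    refine measure_mono_null (fun t ht => ?_) hnull
    simp only [Set.mem_compl_iff, Set.mem_ofPred_eq, f] at ht
    have hmem : (v + coord t w, w') ∈ passageJump := by
      by_contra hnot
      exact ht (by simp [hnot])
    refine Set.mem_biUnion (x := v + coord t w) hmem ?_
    simp
  have hint : ∫⁻ r, ∫⁻ w, f (v + coord r w, shift r w) ∂μ ∂timeMeasure = 0 := by
    simp only [hmarkov]
    have e1 := lintegral_prod (μ := timeMeasure) (ν := μ)
      (fun p : ℝ≥0 × CadlagPath => ∫⁻ w', f (v + coord p.1 p.2, w') ∂μ)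
      hm3.lintegral_prod_right'.aemeasurable
    rw [← e1, lintegral_lintegral_swap hm3.aemeasurable]
    simp only [hzero, lintegral_zero]
  have hm4 : Measurable fun p : ℝ≥0 × CadlagPath => f (v + coord p.1 p.2, shift p.1 p.2) :=
    hf.comp (((measurable_coord_comp measurable_fst measurable_snd).const_add v).prodMk
      (measurable_shift_comp measurable_fst measurable_snd))
  rw [lintegral_eq_zero_iff hm4.lintegral_prod_right'] at hint
  filter_upwards [hint] with r hr
  have hr' : ∫⁻ w, f (v + coord r w, shift r w) ∂μ = 0 := hr
  have hm5 : Measurable fun w => f (v + coord r w, shift r w) :=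
    hf.comp (((measurable_coord r).const_add v).prodMk (measurable_shift r))
  rw [lintegral_eq_zero_iff hm5] at hr'
  filter_upwards [hr'] with w hw hmem
  have : f (v + coord r w, shift r w) = 0 := hw
  simp [f, hmem] at this

/-- A process that spends no time at `-v` does not touch `-v` before passing below it. -/
theorem ae_not_touches (h : IsLevyProcess μ coord) {v : ℝ} (hv : meanOcc μ v = 0) :
    ∀ᵐ w ∂μ, ¬ touches v w := by
  by_cases h0 : meanOcc μ 0 = 0
  · -- Touching at `t` puts every earlier time `r` into the null event of
    -- `ae_ae_notMem_passageJump`; countably many `r` near `0` suffice.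
    have hex : ∀ n : ℕ, ∃ r : ℝ≥0, r < 1 / ((n : ℝ≥0) + 1) ∧
        ∀ᵐ w ∂μ, (v + coord r w, shift r w) ∉ passageJump := fun n => by
      by_contra hno
      push Not at hno
      refine timeMeasure_Iio_pos (ε := 1 / ((n : ℝ≥0) + 1)) (by positivity) ?_
      exact measure_mono_null (fun r hr => hno r hr) (ae_ae_notMem_passageJump h h0 v)
    choose r hr hae using hex
    filter_upwards [ae_all_iff.2 hae] with w hw htouch
    obtain ⟨t, ht, htv, hlt⟩ := htouch
    obtain ⟨n, hn⟩ : ∃ n : ℕ, 1 / ((n : ℝ≥0) + 1) < t := exists_nat_one_div_lt ht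
    exact hw n (mem_passageJump_of_touches ((hr n).trans hn).le htv hlt)
  · -- Restarted at the point `-v` when it is first reached, the process would spend time there.
    -- Before the passage below `-v`, contact with `(-∞, -v]` can only be at `-v` itself.
    have hT : IsOptional (contact (Set.Iic 0) v) := isOptional_contact _ v
    have hTm : Measurable fun w => (contact (Set.Iic 0) v w).toNNReal :=
      hT.measurable.ennreal_toNNReal
    have hA : MeasurableSet {w | contact (Set.Iic 0) v w < ∞} := hT.measurable measurableSet_Iio
    have hE : MeasurableSet {x : ℝ | v + x = 0} :=
      (measurable_id.const_add v) (measurableSet_singleton 0)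
    have key := strongMarkov h hT
      (F := fun _ x w' => ({x : ℝ | v + x = 0}.indicator 1 x : ℝ≥0∞) * occ 0 w')
      (((measurable_one.indicator hE).comp (measurable_snd.comp measurable_fst)).mul
        ((measurable_section measurable_occ 0).comp measurable_snd))
    have hL : ∫⁻ w in {w | contact (Set.Iic 0) v w < ∞},
        ({x : ℝ | v + x = 0}.indicator 1 (coord (contact (Set.Iic 0) v w).toNNReal w) : ℝ≥0∞) *
          occ 0 (shift (contact (Set.Iic 0) v w).toNNReal w) ∂μ = 0 := by
      refine le_antisymm ?_ (zero_le)
      calc _ ≤ ∫⁻ w in {w | contact (Set.Iic 0) v w < ∞}, occ v w ∂μ := by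
            refine lintegral_mono fun w => ?_
            by_cases hw : v + coord (contact (Set.Iic 0) v w).toNNReal w = 0
            · have := occ_shift_le v (contact (Set.Iic 0) v w).toNNReal w
              rw [hw] at this
              simpa [Set.indicator, hw] using this
            · simp [Set.indicator, hw]
        _ ≤ meanOcc μ v := setLIntegral_le_lintegral _ _
        _ = 0 := hv
    have hR : ∀ x : ℝ, ∫⁻ w', ({x : ℝ | v + x = 0}.indicator 1 x : ℝ≥0∞) * occ 0 w' ∂μ =
        {x : ℝ | v + x = 0}.indicator 1 x * meanOcc μ 0 := fun x =>
      lintegral_const_mul _ (measurable_section measurable_occ 0)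
    simp only [hR] at key
    have hm : Measurable fun w =>
        ({x : ℝ | v + x = 0}.indicator 1 (coord (contact (Set.Iic 0) v w).toNNReal w) : ℝ≥0∞) *
          meanOcc μ 0 :=
      ((measurable_one.indicator hE).comp (measurable_coord_comp hTm measurable_id)).mul_const _
    rw [hL, eq_comm, lintegral_eq_zero_iff hm, Filter.EventuallyEq, ae_restrict_iff' hA] at key
    filter_upwards [key, ae_contact_mem h isClosed_Iic v] with w hw hmem htouch
    obtain ⟨t, ht, htv, hlt⟩ := htouch
    have hle : contact (Set.Iic 0) v w ≤ t := contact_le_of_mem (by simp [htv])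
    have hfin : contact (Set.Iic 0) v w < ∞ := hle.trans_lt ENNReal.coe_lt_top
    have h1 : v + coord (contact (Set.Iic 0) v w).toNNReal w ≤ 0 := hmem hfin
    have h2 := coord_ge_of_lt_tauDown (v := v) (w := w)
      (t := (contact (Set.Iic 0) v w).toNNReal) (by
        rw [ENNReal.coe_toNNReal hfin.ne]; exact hle.trans_lt hlt)
    have h3 := hw hfin
    have h4 : v + coord (contact (Set.Iic 0) v w).toNNReal w = 0 := le_antisymm h1 (by linarith)
    simp [Set.indicator, h4, h0] at h3

end

/-! ### One passage below the interval -/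

lemma overshootDown_nonneg {v : ℝ} {w : CadlagPath} (h : tauDown coord v w < ∞) :
    0 ≤ overshootDown coord v w := by
  rw [tauDown_eq] at h
  have hmem := firstHit_mem_closure h
  rw [closure_Iio, Set.mem_Iic, ← tauDown_eq] at hmem
  rw [overshootDown]
  linarith

/-- Without touching, entry from above the interval happens after the passage below `B`. -/
lemma tauDown_le_of_mem {B v : ℝ} {w : CadlagPath} (htouch : ¬ touches v w) {t : ℝ≥0} (ht : 0 < t)
    (hmem : v + B + coord t w ∈ Set.Icc 0 B) : tauDown coord v w ≤ t := by
  by_contra hlt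
  rw [not_le] at hlt
  have h1 := coord_ge_of_lt_tauDown hlt
  have h2 := hmem.2
  exact htouch ⟨t, ht, by linarith, hlt⟩

lemma tauDown_le_returnTime {B v : ℝ} {w : CadlagPath} (htouch : ¬ touches v w) :
    tauDown coord v w ≤ returnTime (Set.Icc 0 B) (v + B) w :=
  le_firstTime fun _ ht => tauDown_le_of_mem htouch ht.1 ht.2

/-- If the undershoot is at most `B`, the path enters the interval when it passes below `B`. -/
lemma returnTime_eq_tauDown {B v : ℝ} (hB : 0 < B) (hv : 0 ≤ v) {w : CadlagPath}
    (htouch : ¬ touches v w) (hfin : tauDown coord v w < ∞) (hle : overshootDown coord v w ≤ B) :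
    returnTime (Set.Icc 0 B) (v + B) w = tauDown coord v w := by
  refine le_antisymm ?_ (tauDown_le_returnTime htouch)
  have h0 := overshootDown_nonneg hfin
  set τ := (tauDown coord v w).toNNReal with hτ
  have hτ' : (τ : ℝ≥0∞) = tauDown coord v w := ENNReal.coe_toNNReal hfin.ne
  rw [overshootDown, ← hτ] at h0 hle
  rcases eq_or_ne τ 0 with hz | hz
  · -- The passage at time `0` is only possible from `v = 0`; then nearby times are entry times.
    rw [hz, coord_zero] at h0
    have hv0 : v = 0 := by linarith
    obtain ⟨r, hr, hge, hlim⟩ := exists_seq_firstTime (S := {t | coord t w < -v}) hfin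
    have hlim' : Filter.Tendsto r Filter.atTop (𝓝 0) := by
      rw [← hz]; exact hlim
    have hlimc : Filter.Tendsto (fun n => coord (r n) w) Filter.atTop (𝓝 0) := by
      have := tendsto_coord_of_ge (w := w) hlim' fun n => zero_le
      rwa [coord_zero] at this
    rw [← hτ', hz]
    refine ge_of_tendsto (ENNReal.tendsto_coe.2 hlim') ?_
    filter_upwards [hlimc.eventually (lt_mem_nhds (neg_lt_zero.2 hB))] with n hn
    have hrn : coord (r n) w < -v := hr n
    refine firstTime_le ⟨?_, ?_, ?_⟩
    · refine lt_of_le_of_ne (zero_le) fun h => ?_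
      rw [← h, coord_zero] at hrn
      linarith
    · linarith
    · linarith
  · rw [← hτ']
    exact firstTime_le ⟨hz.bot_lt, by linarith, by linarith⟩

/-- If the undershoot exceeds `B`, the path jumps over the interval and starts afresh below it. -/
lemma entryTime_eq_tauDown_add {B v : ℝ} {w : CadlagPath}
    (hexit : exitTime coord B (v + B) w = 0) (htouch : ¬ touches v w)
    (hfin : tauDown coord v w < ∞) (hlt : B < overshootDown coord v w) :
    entryTime coord B (v + B) w = (tauDown coord v w).toNNReal +
      entryTime coord B (v + B + coord (tauDown coord v w).toNNReal w)
        (shift (tauDown coord v w).toNNReal w) := by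
  set τ := (tauDown coord v w).toNNReal with hτ
  have hτ' : (τ : ℝ≥0∞) = tauDown coord v w := ENNReal.coe_toNNReal hfin.ne
  rw [overshootDown, ← hτ] at hlt
  have hneg : v + B + coord τ w ∉ Set.Icc 0 B := fun h => by
    have := h.1
    linarith
  rw [entryTime_eq_returnTime hexit, entryTime_eq_returnTime (by rw [exitTime, if_neg hneg]),
    returnTime, returnTime, firstTime_eq_add τ]
  · congr 2
    ext t
    simp only [Set.mem_ofPred_eq, coord_shift, add_add_sub_cancel]
    refine and_congr_left fun hmem => ?_
    have hne : t ≠ 0 := by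
      rintro rfl
      exact hneg (by simpa using hmem)
    exact ⟨fun _ => hne.bot_lt, fun _ => add_pos_of_nonneg_of_pos (zero_le) hne.bot_lt⟩
  · intro t ht
    rw [← ENNReal.coe_le_coe, hτ']
    exact tauDown_le_of_mem htouch ht.1 ht.2

lemma entryVal_eq_down {B v s : ℝ} (hB : 0 < B) (hv : 0 ≤ v) {u : Set ℝ} (hu : u ⊆ Set.Icc 0 B)
    {w : CadlagPath} (hexit : exitTime coord B (v + B) w = 0) (htouch : ¬ touches v w) :
    entryVal B s u (v + B) w =
      disc s (tauDown coord v w) * {r | B - r ∈ u}.indicator 1 (overshootDown coord v w) +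
      {w | tauDown coord v w < ∞}.indicator (fun w => disc s (tauDown coord v w).toNNReal *
        (Set.Iio (-(v + B))).indicator 1 (coord (tauDown coord v w).toNNReal w) *
        entryVal B s u (v + B + coord (tauDown coord v w).toNNReal w)
          (shift (tauDown coord v w).toNNReal w)) w := by
  by_cases hfin : tauDown coord v w < ∞
  · rw [Set.indicator_of_mem (show w ∈ {w | tauDown coord v w < ∞} from hfin),
      ENNReal.coe_toNNReal hfin.ne]
    rcases le_or_gt (overshootDown coord v w) B with hle | hlt
    · have hnot : coord (tauDown coord v w).toNNReal w ∉ Set.Iio (-(v + B)) := by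
        rw [overshootDown] at hle
        simp only [Set.mem_Iio, not_lt]
        linarith
      have hret : entryTime coord B (v + B) w = tauDown coord v w := by
        rw [entryTime_eq_returnTime hexit, returnTime_eq_tauDown hB hv htouch hfin hle]
      have hpos : entryPos coord B (v + B) w = B - overshootDown coord v w := by
        rw [entryPos, hret, overshootDown]
        ring
      rw [Set.indicator_of_notMem hnot, mul_zero, zero_mul, add_zero, entryVal, hret, hpos]
      rfl
    · have hmem : coord (tauDown coord v w).toNNReal w ∈ Set.Iio (-(v + B)) := by
        rw [overshootDown] at hlt
        simp only [Set.mem_Iio]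
        linarith
      have hnot : overshootDown coord v w ∉ {r | B - r ∈ u} := fun h => by
        have h' : B - overshootDown coord v w ∈ u := h
        have := (hu h').1
        linarith
      have he := entryTime_eq_tauDown_add hexit htouch hfin hlt
      rw [Set.indicator_of_notMem hnot, mul_zero, zero_add, Set.indicator_of_mem hmem,
        Pi.one_apply, mul_one, entryVal, entryVal, he, disc_add, ENNReal.coe_toNNReal hfin.ne,
        mul_assoc]
      by_cases hinf : entryTime coord B (v + B + coord (tauDown coord v w).toNNReal w)
          (shift (tauDown coord v w).toNNReal w) = ∞
      · simp [hinf, disc_top]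
      · rw [entryPos_eq_of_entryTime_eq he hinf]
  · have htop := not_lt_top_iff.1 hfin
    have hret : returnTime (Set.Icc 0 B) (v + B) w = ∞ :=
      top_le_iff.1 (by rw [← htop]; exact tauDown_le_returnTime htouch)
    rw [Set.indicator_of_notMem (show w ∉ {w | tauDown coord v w < ∞} from hfin), htop, disc_top,
      zero_mul, zero_add, entryVal, entryTime_eq_returnTime hexit, hret, disc_top, zero_mul]

section

variable {μ : Measure CadlagPath} [IsProbabilityMeasure μ]

lemma indicator_overshootDown {B v : ℝ} (f : ℝ → ℝ≥0∞) (w : CadlagPath) :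
    (Set.Ioi 0).indicator f (overshootDown coord v w - B) =
      (Set.Iio (-(v + B))).indicator 1 (coord (tauDown coord v w).toNNReal w) *
        f (-(v + B + coord (tauDown coord v w).toNNReal w)) := by
  have hx : overshootDown coord v w - B = -(v + B + coord (tauDown coord v w).toNNReal w) := by
    rw [overshootDown]; ring
  rw [hx]
  by_cases h : coord (tauDown coord v w).toNNReal w < -(v + B)
  · rw [Set.indicator_of_mem (show coord (tauDown coord v w).toNNReal w ∈ Set.Iio _ from h),
      Set.indicator_of_mem (Set.mem_Ioi.2 (by linarith)), Pi.one_apply, one_mul]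
  · rw [Set.indicator_of_notMem (show coord (tauDown coord v w).toNNReal w ∉ Set.Iio _ from h),
      Set.indicator_of_notMem (by simp only [Set.mem_Ioi]; linarith), zero_mul]

/-- The first-step equation for a start above the interval. -/
theorem entryLaw_down (h : IsLevyProcess μ coord) {B s v : ℝ} (hB : 0 < B) (hv : 0 ≤ v)
    (hexit : ∀ᵐ w ∂μ, exitTime coord B (v + B) w = 0) (hocc : meanOcc μ v = 0)
    {u : Set ℝ} (hum : MeasurableSet u) (hu : u ⊆ Set.Icc 0 B) :
    entryLaw μ coord B s (v + B) u = downLaw μ coord s v {r | B - r ∈ u} +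
      ∫⁻ l, entryLaw μ coord B s (-l) u ∂(downJumpLaw μ coord B s v) := by
  have hum' : MeasurableSet {r | B - r ∈ u} := (measurable_id.const_sub B) hum
  have hτm : Measurable (tauDown coord v) := measurable_section measurable_tauDown v
  have hA : MeasurableSet {w | tauDown coord v w < ∞} := hτm measurableSet_Iio
  have hE : Measurable fun l => entryLaw μ coord B s (-l) u :=
    (measurable_entryLaw_apply h B s hum).comp measurable_neg
  have hg : Measurable fun p : ℝ≥0 × ℝ =>
      disc s p.1 * (Set.Iio (-(v + B))).indicator 1 p.2 :=
    ((measurable_disc s).comp (measurable_coe_nnreal_ennreal.comp measurable_fst)).mul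
      ((measurable_one.indicator measurableSet_Iio).comp measurable_snd)
  have key := lintegral_entryVal_shift h B s (v + B) hum (isOptional_tauDown v)
    (g := fun t x => disc s t * (Set.Iio (-(v + B))).indicator 1 x) hg
  have hm1 : Measurable fun w => disc s (tauDown coord v w) *
      {r | B - r ∈ u}.indicator (1 : ℝ → ℝ≥0∞) (overshootDown coord v w) :=
    ((measurable_disc s).comp hτm).mul ((measurable_one.indicator hum').comp
      (measurable_section measurable_overshootDown v))
  rw [entryLaw_apply h B s _ hum, lintegral_congr_ae (g := fun w =>
      disc s (tauDown coord v w) * {r | B - r ∈ u}.indicator 1 (overshootDown coord v w) +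
      {w | tauDown coord v w < ∞}.indicator (fun w => disc s (tauDown coord v w).toNNReal *
        (Set.Iio (-(v + B))).indicator 1 (coord (tauDown coord v w).toNNReal w) *
        entryVal B s u (v + B + coord (tauDown coord v w).toNNReal w)
          (shift (tauDown coord v w).toNNReal w)) w) ?_, lintegral_add_left hm1,
    lintegral_indicator hA, key, ← lintegral_indicator_one hum',
    lintegral_downLaw s v (measurable_one.indicator hum'), lintegral_downJumpLaw B s v hE]
  · congr 1
    rw [← lintegral_indicator hA]
    refine lintegral_congr fun w => ?_
    rw [indicator_overshootDown, neg_neg]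
    by_cases hfin : tauDown coord v w < ∞
    · rw [Set.indicator_of_mem (show w ∈ {w | tauDown coord v w < ∞} from hfin),
        ENNReal.coe_toNNReal hfin.ne, mul_assoc]
    · rw [Set.indicator_of_notMem (show w ∉ {w | tauDown coord v w < ∞} from hfin),
        not_lt_top_iff.1 hfin, disc_top, zero_mul]
  · filter_upwards [hexit, ae_not_touches h hocc] with w hw1 hw2
    exact entryVal_eq_down hB hv hu hw1 hw2

/-- Started at `z`, the process spends no time at `0` or `B`. -/
def Avoids (μ : Measure CadlagPath) (B z : ℝ) : Prop := meanOcc μ z = 0 ∧ meanOcc μ (z - B) = 0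

lemma measurableSet_avoids (B : ℝ) : MeasurableSet {z | Avoids μ B z} :=
  (measurable_meanOcc (measurableSet_singleton 0)).inter
    ((measurable_meanOcc.comp (measurable_id.sub_const B)) (measurableSet_singleton 0))

/-- Avoidance of the ends is inherited by the position after a passage over the interval. -/
lemma ae_avoids_down (h : IsLevyProcess μ coord) {B v : ℝ} (s : ℝ) (hv : Avoids μ B (v + B)) :
    ∀ᵐ l ∂(downJumpLaw μ coord B s v), 0 < l ∧ Avoids μ B (-l) := by
  have hpos : ∀ᵐ l ∂(downJumpLaw μ coord B s v), 0 < l := ae_restrict_mem measurableSet_Ioi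
  have hf : Measurable fun l : ℝ => meanOcc μ (-l) + meanOcc μ (-l - B) :=
    (measurable_meanOcc.comp measurable_neg).add
      (measurable_meanOcc.comp (measurable_neg.sub_const B))
  have h0 : ∫⁻ l, (meanOcc μ (-l) + meanOcc μ (-l - B)) ∂(downJumpLaw μ coord B s v) = 0 := by
    rw [lintegral_downJumpLaw B s v hf]
    refine lintegral_eq_zero_of_ae_eq_zero ?_
    filter_upwards [ae_meanOcc_shift h hv.1 (isOptional_tauDown v),
      ae_meanOcc_shift h hv.2 (isOptional_tauDown v)] with w hw1 hw2
    rw [indicator_overshootDown, neg_neg]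
    by_cases hfin : tauDown coord v w < ∞
    · have e : v + B + coord (tauDown coord v w).toNNReal w - B =
          v + B - B + coord (tauDown coord v w).toNNReal w := by ring
      rw [hw1 hfin, e, hw2 hfin]
      simp
    · rw [not_lt_top_iff.1 hfin, disc_top, zero_mul]
      rfl
  rw [lintegral_eq_zero_iff hf] at h0
  filter_upwards [hpos, h0] with l hl hl0
  have : meanOcc μ (-l) + meanOcc μ (-l - B) = 0 := hl0
  exact ⟨hl, add_eq_zero.1 this⟩

lemma exitTime_eq_zero {B y : ℝ} (w : CadlagPath) (h : y ∉ Set.Icc 0 B) :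
    exitTime coord B y w = 0 := by
  rw [exitTime, if_neg h]

end

/-! ### Transfer to the path space and reflection -/

section Transfer

variable {Ω : Type*} [MeasurableSpace Ω] {P : Measure Ω} {ξ : ℝ≥0 → Ω → ℝ}

lemma upLaw_eq (h : IsLevyProcess P ξ) (s : ℝ) :
    upLaw P ξ s = upLaw (P.map (path h)) coord s :=
  funext fun x => transform_comp (measurable_path h)
    (measurable_section measurable_tauUp x).aemeasurable
    (measurable_section measurable_overshootUp x).aemeasurable MeasurableSet.univ

lemma downLaw_eq (h : IsLevyProcess P ξ) (s : ℝ) :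
    downLaw P ξ s = downLaw (P.map (path h)) coord s :=
  funext fun x => transform_comp (measurable_path h)
    (measurable_section measurable_tauDown x).aemeasurable
    (measurable_section measurable_overshootDown x).aemeasurable MeasurableSet.univ

lemma exitAboveLaw_eq (h : IsLevyProcess P ξ) (B s y : ℝ) :
    exitAboveLaw P ξ B s y = exitAboveLaw (P.map (path h)) coord B s y := by
  have hpos : Measurable (exitPos coord B y) := measurable_section (measurable_exitPos B) y
  have hY : Measurable fun w => exitPos coord B y w - B := hpos.sub_const B
  have hA : MeasurableSet (exitAbove coord B y) := hpos measurableSet_Ici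
  have hτ : Measurable (exitTime coord B y) := measurable_section (measurable_exitTime B) y
  have := transform_comp (Q := P) (s := s) (measurable_path h) hτ.aemeasurable hY.aemeasurable hA
  exact this

lemma exitBelowLaw_eq (h : IsLevyProcess P ξ) (B s y : ℝ) :
    exitBelowLaw P ξ B s y = exitBelowLaw (P.map (path h)) coord B s y := by
  have hpos : Measurable (exitPos coord B y) := measurable_section (measurable_exitPos B) y
  have hY : Measurable fun w => -exitPos coord B y w := hpos.neg
  have hA : MeasurableSet (exitBelow coord B y) := hpos measurableSet_Iic
  have hτ : Measurable (exitTime coord B y) := measurable_section (measurable_exitTime B) y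
  have := transform_comp (Q := P) (s := s) (measurable_path h) hτ.aemeasurable hY.aemeasurable hA
  exact this

lemma ae_exitTime_eq_zero (h : IsLevyProcess P ξ) {B y : ℝ}
    (he : ∀ᵐ ω ∂P, exitTime ξ B y ω = 0) : ∀ᵐ w ∂(P.map (path h)), exitTime coord B y w = 0 :=
  (ae_map_iff (measurable_path h).aemeasurable
    (measurable_section (measurable_exitTime B) y (measurableSet_singleton 0))).2 he

variable [IsProbabilityMeasure P]

lemma isProbabilityMeasure_map_path (h : IsLevyProcess P ξ) :
    IsProbabilityMeasure (P.map (path h)) :=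
  Measure.isProbabilityMeasure_map (measurable_path h).aemeasurable

lemma entryLaw_eq (h : IsLevyProcess P ξ) (B s : ℝ) :
    entryLaw P ξ B s = entryLaw (P.map (path h)) coord B s := by
  have := isProbabilityMeasure_map_path h
  have hμ := isLevyProcess_map_path h
  exact funext fun y => transform_comp (measurable_path h)
    (aemeasurable_entryTime hμ B y) (aemeasurable_entryPos hμ B y) MeasurableSet.univ

lemma meanOcc_map_path (h : IsLevyProcess P ξ) (z : ℝ) :
    meanOcc (P.map (path h)) z = ∫⁻ t, P {ω | z + ξ t ω = 0} ∂timeMeasure := by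
  have := isProbabilityMeasure_map_path h
  rw [meanOcc_eq]
  refine lintegral_congr fun t => ?_
  have hm : MeasurableSet {w | z + coord t w = 0} :=
    ((measurable_coord t).const_add z) (measurableSet_singleton 0)
  rw [Measure.map_apply (measurable_path h) hm]
  rfl

lemma avoids_of_noTimeAtEnds (h : IsLevyProcess P ξ) {B z : ℝ} (hz : NoTimeAtEnds P ξ B z) :
    Avoids (P.map (path h)) B z := by
  have key : ∀ c : ℝ, (∀ t, {ω | z - c + ξ t ω = 0} ⊆ {ω | z + ξ t ω = 0 ∨ z + ξ t ω = B}) →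
      meanOcc (P.map (path h)) (z - c) = 0 := by
    intro c hc
    have hm : Measurable fun t : ℝ≥0 => P {ω | z - c + ξ t ω = 0} := by
      have h1 : MeasurableSet {p : ℝ≥0 × Ω | z - c + ξ p.1 p.2 = 0} := by
        have h2 : Measurable fun p : ℝ≥0 × Ω => z - c + coord p.1 (path h p.2) :=
          (measurable_coord_comp measurable_fst ((measurable_path h).comp measurable_snd)).const_add _
        exact h2 (measurableSet_singleton 0)
      exact measurable_measure_prodMk_left h1
    rw [meanOcc_map_path]
    refine lintegral_eq_zero_of_ae_eq_zero (timeMeasure_ae (hm (measurableSet_singleton 0)) ?_)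
    filter_upwards [hz] with t ht
    exact measure_mono_null (hc _) ht
  constructor
  · simpa using key 0 fun t ω hω => Or.inl (by simpa using hω)
  · refine key B fun t ω hω => Or.inr ?_
    have : z - B + ξ t ω = 0 := hω
    change z + ξ t ω = B
    linarith

end Transfer

section Reflection

variable {μ : Measure CadlagPath}

/-- The law of the reflected process. -/
def reflected (h : IsLevyProcess μ coord) : Measure CadlagPath := μ.map (path h.neg)

lemma tauUp_neg (x : ℝ) (w : CadlagPath) :
    tauUp (fun t w => -coord t w) x w = tauDown coord x w := by
  simp only [tauUp, tauDown, lt_neg]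

lemma tauDown_neg (x : ℝ) (w : CadlagPath) :
    tauDown (fun t w => -coord t w) x w = tauUp coord x w := by
  simp only [tauUp, tauDown, neg_lt_neg_iff]

lemma overshootUp_neg (x : ℝ) (w : CadlagPath) :
    overshootUp (fun t w => -coord t w) x w = overshootDown coord x w := by
  simp only [overshootUp, overshootDown, tauUp_neg]

lemma overshootDown_neg (x : ℝ) (w : CadlagPath) :
    overshootDown (fun t w => -coord t w) x w = overshootUp coord x w := by
  simp only [overshootUp, overshootDown, tauDown_neg, neg_neg]

lemma upLaw_reflected (h : IsLevyProcess μ coord) (s : ℝ) :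
    upLaw (reflected h) coord s = downLaw μ coord s := by
  rw [reflected, ← upLaw_eq h.neg]
  funext x
  rw [upLaw, downLaw, funext (tauUp_neg x), funext (overshootUp_neg x)]

lemma downLaw_reflected (h : IsLevyProcess μ coord) (s : ℝ) :
    downLaw (reflected h) coord s = upLaw μ coord s := by
  rw [reflected, ← downLaw_eq h.neg]
  funext x
  rw [upLaw, downLaw, funext (tauDown_neg x), funext (overshootDown_neg x)]

lemma upJumpLaw_reflected (h : IsLevyProcess μ coord) (B s : ℝ) :
    upJumpLaw (reflected h) coord B s = downJumpLaw μ coord B s := by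
  funext x
  rw [upJumpLaw, upLaw_reflected, downJumpLaw]

lemma downJumpLaw_reflected (h : IsLevyProcess μ coord) (B s : ℝ) :
    downJumpLaw (reflected h) coord B s = upJumpLaw μ coord B s := by
  funext x
  rw [downJumpLaw, downLaw_reflected, upJumpLaw]

lemma Qplus_reflected (h : IsLevyProcess μ coord) (B s : ℝ) :
    Qplus (reflected h) coord B s = Qminus μ coord B s := by
  funext x
  rw [Qplus, Qminus, upJumpLaw_reflected, downJumpLaw_reflected]

variable [IsProbabilityMeasure μ]

instance (h : IsLevyProcess μ coord) : IsProbabilityMeasure (reflected h) :=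
  isProbabilityMeasure_map_path h.neg

lemma isLevyProcess_reflected (h : IsLevyProcess μ coord) : IsLevyProcess (reflected h) coord :=
  isLevyProcess_map_path h.neg

lemma mem_Icc_reflect {B x : ℝ} : B - x ∈ Set.Icc 0 B ↔ x ∈ Set.Icc 0 B := by
  simp only [Set.mem_Icc]
  constructor <;> rintro ⟨h1, h2⟩ <;> constructor <;> linarith

lemma exitTime_neg (B y : ℝ) (w : CadlagPath) :
    exitTime (fun t w => -coord t w) B y w = exitTime coord B (B - y) w := by
  have hS : {t : ℝ≥0 | y + -coord t w ∉ Set.Icc 0 B} =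
      {t : ℝ≥0 | B - y + coord t w ∉ Set.Icc 0 B} := by
    ext t
    have e : B - y + coord t w = B - (y + -coord t w) := by ring
    simp only [Set.mem_ofPred_eq, e, mem_Icc_reflect]
  simp only [exitTime, hS, mem_Icc_reflect]

lemma entryTime_neg (B y : ℝ) (w : CadlagPath) :
    entryTime (fun t w => -coord t w) B y w = entryTime coord B (B - y) w := by
  simp only [entryTime, exitTime_neg]
  congr 1
  ext t
  have e : B - y + coord t w = B - (y + -coord t w) := by ring
  simp only [Set.mem_ofPred_eq, e, mem_Icc_reflect]

lemma entryPos_neg (B y : ℝ) (w : CadlagPath) :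
    entryPos (fun t w => -coord t w) B y w = B - entryPos coord B (B - y) w := by
  simp only [entryPos, entryTime_neg]
  ring

lemma entryLaw_reflected (h : IsLevyProcess μ coord) (B s y : ℝ) {u : Set ℝ}
    (hu : MeasurableSet u) :
    entryLaw (reflected h) coord B s y u = entryLaw μ coord B s (B - y) {r | B - r ∈ u} := by
  have hu' : MeasurableSet {r | B - r ∈ u} := (measurable_id.const_sub B) hu
  rw [reflected, ← entryLaw_eq h.neg, entryLaw_apply h B s _ hu', entryLaw,
    funext (entryTime_neg B y), funext (entryPos_neg B y),
    transform_apply (aemeasurable_entryTime h B (B - y))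
      ((aemeasurable_entryPos h B (B - y)).const_sub B) MeasurableSet.univ hu,
    Measure.restrict_univ]
  rfl

lemma meanOcc_reflected (h : IsLevyProcess μ coord) (z : ℝ) :
    meanOcc (reflected h) z = meanOcc μ (-z) := by
  rw [reflected, meanOcc_map_path, meanOcc_eq]
  refine lintegral_congr fun t => ?_
  congr 1
  ext w
  simp only [Set.mem_ofPred_eq]
  constructor <;> intro h <;> linarith

lemma avoids_reflected (h : IsLevyProcess μ coord) (B z : ℝ) :
    Avoids (reflected h) B z ↔ Avoids μ B (B - z) := by
  rw [Avoids, Avoids, meanOcc_reflected, meanOcc_reflected, and_comm, neg_sub,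
    show B - z - B = -z by ring]

/-- The first-step equation for a start below the interval. -/
theorem entryLaw_up (h : IsLevyProcess μ coord) {B s l : ℝ} (hB : 0 < B) (hl : 0 < l)
    (hocc : Avoids μ B (-l)) {u : Set ℝ} (hum : MeasurableSet u) (hu : u ⊆ Set.Icc 0 B) :
    entryLaw μ coord B s (-l) u = upLaw μ coord s l u +
      ∫⁻ x, entryLaw μ coord B s (x + B) u ∂(upJumpLaw μ coord B s l) := by
  have hum' : MeasurableSet {r | B - r ∈ u} := (measurable_id.const_sub B) hum
  have hinv : {r | B - r ∈ {r | B - r ∈ u}} = u := by ext r; simp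
  have key := entryLaw_down (isLevyProcess_reflected h) (s := s) hB hl.le
    (ae_of_all _ fun w => exitTime_eq_zero w fun hm => by have := hm.2; linarith)
    (by rw [meanOcc_reflected]; exact hocc.1) hum' (fun r hr => mem_Icc_reflect.1 (hu hr))
  simp only [entryLaw_reflected h B s _ hum', downLaw_reflected, downJumpLaw_reflected, hinv] at key
  rw [show B - (l + B) = -l by ring] at key
  rw [key]
  congr 1
  refine lintegral_congr fun x => ?_
  rw [show B - -x = x + B by ring]

lemma ae_avoids_up (h : IsLevyProcess μ coord) {B l : ℝ} (s : ℝ) (hl : Avoids μ B (-l)) :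
    ∀ᵐ x ∂(upJumpLaw μ coord B s l), 0 < x ∧ Avoids μ B (x + B) := by
  have := ae_avoids_down (isLevyProcess_reflected h) (B := B) (v := l) s
    ((avoids_reflected h B _).2 (by rwa [show B - (l + B) = -l by ring]))
  rw [downJumpLaw_reflected] at this
  filter_upwards [this] with x hx
  refine ⟨hx.1, ?_⟩
  have := (avoids_reflected h B _).1 hx.2
  rwa [show B - -x = x + B by ring] at this

end Reflection

/-! ### Neumann series of a kernel -/

section Neumann

variable {Q : ℝ → Measure ℝ} {ρ : ℝ≥0∞}

lemma iterKernel_univ_le (hQ : Measurable Q) (hρ : ∀ v, Q v Set.univ ≤ ρ) (n : ℕ) (v : ℝ) :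
    iterKernel Q n v Set.univ ≤ ρ ^ (n + 1) := by
  induction n with
  | zero => simpa [iterKernel] using hρ v
  | succ n ih =>
    rw [iterKernel, Measure.bind_apply MeasurableSet.univ hQ.aemeasurable, pow_succ' ρ (n + 1)]
    calc ∫⁻ l, Q l Set.univ ∂(iterKernel Q n v) ≤ ∫⁻ _, ρ ∂(iterKernel Q n v) :=
          lintegral_mono fun l => hρ l
      _ ≤ _ := by
          rw [lintegral_const]
          gcongr

lemma resolventKernel_univ_lt_top (hQ : Measurable Q) (hρ : ∀ v, Q v Set.univ ≤ ρ) (h1 : ρ < 1)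
    (v : ℝ) : resolventKernel Q v Set.univ < ∞ := by
  have hsum : ∑' n : ℕ, ρ ^ (n + 1) < ∞ := by
    simp only [pow_succ]
    rw [ENNReal.tsum_mul_right, ENNReal.tsum_geometric]
    exact ENNReal.mul_lt_top (ENNReal.inv_lt_top.2 (tsub_pos_of_lt h1)) (h1.trans ENNReal.one_lt_top)
  rw [resolventKernel, Measure.add_apply, Measure.sum_apply _ MeasurableSet.univ, measure_univ]
  exact ENNReal.add_lt_top.2 ⟨ENNReal.one_lt_top,
    (ENNReal.tsum_le_tsum fun n => iterKernel_univ_le hQ hρ n v).trans_lt hsum⟩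

/-- The bounded solution of the renewal equation `b = g + Q b`, which is only assumed to hold on
a set that the kernel does not leave, is the Neumann series applied to `g`. -/
lemma eq_lintegral_resolventKernel (hQ : Measurable Q) (hρ : ∀ v, Q v Set.univ ≤ ρ) (h1 : ρ < 1)
    {b g : ℝ → ℝ≥0∞} (hb : Measurable b) (hg : Measurable g) (hb1 : ∀ w, b w ≤ 1) {G : Set ℝ}
    (hstep : ∀ w ∈ G, b w = g w + ∫⁻ x, b x ∂(Q w)) (hG : ∀ w ∈ G, ∀ᵐ x ∂(Q w), x ∈ G)
    (hGm : MeasurableSet G) {v : ℝ} (hv : b v = g v + ∫⁻ x, b x ∂(Q v))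
    (hvG : ∀ᵐ x ∂(Q v), x ∈ G) :
    b v = ∫⁻ x, g x ∂(resolventKernel Q v) := by
  have hae : ∀ n, ∀ᵐ x ∂(iterKernel Q n v), x ∈ G := by
    intro n
    induction n with
    | zero => exact hvG
    | succ n ih =>
      change ((iterKernel Q n v).bind Q) Gᶜ = 0
      rw [Measure.bind_apply hGm.compl hQ.aemeasurable]
      refine lintegral_eq_zero_of_ae_eq_zero ?_
      filter_upwards [ih] with x hx
      exact ae_iff.1 (hG x hx)
  have hn : ∀ n, b v = g v + ∑ k ∈ Finset.range n, ∫⁻ x, g x ∂(iterKernel Q k v) +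
      ∫⁻ x, b x ∂(iterKernel Q n v) := by
    intro n
    induction n with
    | zero => simpa [iterKernel] using hv
    | succ n ih =>
      have hsplit : ∫⁻ x, b x ∂(iterKernel Q n v) =
          ∫⁻ x, g x ∂(iterKernel Q n v) + ∫⁻ x, b x ∂(iterKernel Q (n + 1) v) := by
        rw [iterKernel, Measure.lintegral_bind hQ.aemeasurable hb.aemeasurable,
          ← lintegral_add_left hg]
        exact lintegral_congr_ae ((hae n).mono fun x hx => hstep x hx)
      rw [ih, hsplit, Finset.sum_range_succ]
      ring
  have hrem : Filter.Tendsto (fun n => ∫⁻ x, b x ∂(iterKernel Q n v)) Filter.atTop (𝓝 0) := by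
    refine tendsto_of_tendsto_of_tendsto_of_le_of_le tendsto_const_nhds
      ((ENNReal.tendsto_pow_atTop_nhds_zero_of_lt_one h1).comp (Filter.tendsto_add_atTop_nat 1))
      (fun n => zero_le) fun n => ?_
    calc ∫⁻ x, b x ∂(iterKernel Q n v) ≤ ∫⁻ _, 1 ∂(iterKernel Q n v) :=
          lintegral_mono fun x => hb1 x
      _ ≤ _ := by
          rw [lintegral_one]
          exact iterKernel_univ_le hQ hρ n v
  have hlim := ((ENNReal.tendsto_nat_tsum fun k => ∫⁻ x, g x ∂(iterKernel Q k v)).const_add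
    (g v)).add hrem
  rw [resolventKernel, lintegral_add_measure, lintegral_dirac' _ hg, lintegral_sum_measure,
    ← add_zero (g v + _)]
  exact tendsto_nhds_unique (tendsto_const_nhds.congr hn) hlim

end Neumann

/-! ### The mass of the jump kernels -/

lemma indicator_one_le (A : Set ℝ) (x : ℝ) : A.indicator (1 : ℝ → ℝ≥0∞) x ≤ 1 :=
  Set.indicator_apply_le' (fun _ => le_rfl) fun _ => zero_le

lemma disc_anti {s : ℝ} (hs : 0 ≤ s) {a b : ℝ≥0∞} (h : a ≤ b) : disc s b ≤ disc s a := by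
  obtain ⟨c, rfl⟩ := exists_add_of_le h
  rw [disc_add]
  exact mul_le_of_le_one_right' (disc_le_one hs c)

lemma disc_lt_one {s : ℝ} (hs : 0 < s) {a : ℝ≥0∞} (ha : 0 < a) : disc s a < 1 := by
  rw [disc]
  split_ifs with h
  · exact zero_lt_one
  · rw [ENNReal.ofReal_lt_one, Real.exp_lt_one_iff, neg_lt_zero]
    exact mul_pos hs (ENNReal.toReal_pos ha.ne' h)

lemma tauDown_pos {B : ℝ} (hB : 0 < B) (w : CadlagPath) : 0 < tauDown coord B w := by
  refine pos_iff_ne_zero.2 fun h => ?_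
  obtain ⟨r, hr, hge, hlim⟩ := exists_seq_firstTime (S := {t | coord t w < -B})
    (show tauDown coord B w < ∞ from h ▸ ENNReal.zero_lt_top)
  have h0 : (firstTime {t | coord t w < -B}).toNNReal = 0 := by
    rw [show firstTime {t | coord t w < -B} = 0 from h, ENNReal.toNNReal_zero]
  rw [h0] at hlim
  have hlimc := tendsto_coord_of_ge (w := w) hlim fun n => zero_le
  rw [coord_zero] at hlimc
  have := le_of_tendsto hlimc (Filter.Eventually.of_forall fun n =>
    (show coord (r n) w < -B from hr n).le)
  linarith

section Mass

variable {μ : Measure CadlagPath} [IsProbabilityMeasure μ]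

lemma downJumpLaw_univ_le {s : ℝ} (hs : 0 ≤ s) (B v : ℝ) :
    downJumpLaw μ coord B s v Set.univ ≤ 1 := by
  rw [← lintegral_one, lintegral_downJumpLaw B s v measurable_const]
  calc _ ≤ ∫⁻ _, 1 ∂μ := lintegral_mono fun w =>
        mul_le_one' (disc_le_one hs _) (indicator_one_le _ _)
    _ = 1 := by rw [lintegral_one, measure_univ]

/-- An undershoot larger than `B` needs a passage below `-B`. With positive probability this takes
longer than some fixed time, so discounting makes the mass smaller than `1`, uniformly in the
level. -/
lemma exists_downJumpLaw_le {B s : ℝ} (hB : 0 < B) (hs : 0 < s) :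
    ∃ ρ < 1, ∀ l, 0 ≤ l → downJumpLaw μ coord B s l Set.univ ≤ ρ := by
  have hτm : Measurable (tauDown coord B) := measurable_section measurable_tauDown B
  have hE : ∀ n : ℕ, MeasurableSet {w | tauDown coord B w < (n : ℝ≥0∞)⁻¹} := fun n =>
    hτm measurableSet_Iio
  have hlim := tendsto_measure_iInter_atTop (μ := μ) (fun n => (hE n).nullMeasurableSet)
    (fun m n hmn w hw => lt_of_lt_of_le hw (ENNReal.inv_le_inv.2 (by exact_mod_cast hmn)))
    ⟨0, measure_ne_top _ _⟩
  have hempty : ⋂ n : ℕ, {w | tauDown coord B w < (n : ℝ≥0∞)⁻¹} = ∅ := by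
    refine Set.eq_empty_of_forall_notMem fun w hw => ?_
    obtain ⟨n, hn⟩ := ENNReal.exists_inv_nat_lt (tauDown_pos hB w).ne'
    exact lt_asymm hn (Set.mem_iInter.1 hw n)
  rw [hempty, measure_empty] at hlim
  obtain ⟨n, hn⟩ := (hlim.eventually (gt_mem_nhds zero_lt_one)).exists
  set E : Set CadlagPath := {w | tauDown coord B w < (n : ℝ≥0∞)⁻¹} with hEdef
  set c := disc s (n : ℝ≥0∞)⁻¹ with hc
  have hc1 : c < 1 := disc_lt_one hs (ENNReal.inv_pos.2 (ENNReal.natCast_ne_top n))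
  have hEc : μ Eᶜ ≠ 0 := by
    rw [prob_compl_eq_one_sub (hE n)]
    exact (tsub_pos_of_lt hn).ne'
  refine ⟨μ E + c * μ Eᶜ, ?_, fun l hl => ?_⟩
  · calc μ E + c * μ Eᶜ < μ E + 1 * μ Eᶜ :=
          ENNReal.add_lt_add_left (measure_ne_top _ _)
            ((ENNReal.mul_lt_mul_iff_left hEc (measure_ne_top _ _)).2 hc1)
      _ = 1 := by rw [one_mul, prob_add_prob_compl (hE n)]
  · rw [← lintegral_one, lintegral_downJumpLaw B s l measurable_const]
    calc _ ≤ ∫⁻ w, (E.indicator 1 w + Eᶜ.indicator (fun _ => c) w) ∂μ := by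
          refine lintegral_mono fun w => ?_
          rw [indicator_overshootDown, mul_one]
          by_cases hw : w ∈ E
          · rw [Set.indicator_of_mem hw, Set.indicator_of_notMem (Set.notMem_compl_iff.2 hw), add_zero,
              Pi.one_apply]
            exact mul_le_one' (disc_le_one hs.le _) (indicator_one_le _ _)
          · rw [Set.indicator_of_notMem hw, Set.indicator_of_mem (show w ∈ Eᶜ from hw), zero_add]
            by_cases hx : coord (tauDown coord l w).toNNReal w < -(l + B)
            · refine (mul_le_of_le_one_right' (indicator_one_le _ _)).trans ?_
              by_cases hfin : tauDown coord l w = ∞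
              · rw [hfin, disc_top]
                exact zero_le
              · refine disc_anti hs.le ((not_lt.1 hw).trans ?_)
                rw [← ENNReal.coe_toNNReal hfin]
                exact firstTime_le (show coord _ w < -B by linarith)
            · rw [Set.indicator_of_notMem
                (show coord (tauDown coord l w).toNNReal w ∉ Set.Iio _ from hx), mul_zero]
              exact zero_le
      _ = μ E + c * μ Eᶜ := by
          rw [lintegral_add_left (measurable_one.indicator (hE n)), lintegral_indicator_one (hE n),
            lintegral_indicator_const (hE n).compl]

lemma exists_upJumpLaw_le (h : IsLevyProcess μ coord) {B s : ℝ} (hB : 0 < B) (hs : 0 < s) :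
    ∃ ρ < 1, ∀ l, 0 ≤ l → upJumpLaw μ coord B s l Set.univ ≤ ρ := by
  simpa only [downJumpLaw_reflected] using exists_downJumpLaw_le (μ := reflected h) hB hs

lemma measurable_Qplus (B s : ℝ) : Measurable (Qplus μ coord B s) :=
  (Measure.measurable_bind' (measurable_upJumpLaw B s)).comp (measurable_downJumpLaw B s)

lemma exists_Qplus_le (h : IsLevyProcess μ coord) {B s : ℝ} (hB : 0 < B) (hs : 0 < s) :
    ∃ ρ < 1, ∀ v, Qplus μ coord B s v Set.univ ≤ ρ := by
  obtain ⟨ρ, hρ, hle⟩ := exists_upJumpLaw_le h hB hs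
  refine ⟨ρ, hρ, fun v => ?_⟩
  have hpos : ∀ᵐ l ∂(downJumpLaw μ coord B s v), 0 < l := ae_restrict_mem measurableSet_Ioi
  rw [Qplus, Measure.bind_apply MeasurableSet.univ (measurable_upJumpLaw B s).aemeasurable]
  calc _ ≤ ∫⁻ _, ρ ∂(downJumpLaw μ coord B s v) :=
        lintegral_mono_ae (hpos.mono fun l hl => hle l hl.le)
    _ ≤ ρ := by
        rw [lintegral_const]
        exact mul_le_of_le_one_right' (downJumpLaw_univ_le hs.le B v)

lemma resolventKernel_Qplus_lt_top (h : IsLevyProcess μ coord) {B s : ℝ} (hB : 0 < B) (hs : 0 < s)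
    (v : ℝ) : resolventKernel (Qplus μ coord B s) v Set.univ < ∞ := by
  obtain ⟨ρ, hρ, hle⟩ := exists_Qplus_le h hB hs
  exact resolventKernel_univ_lt_top (measurable_Qplus B s) hle hρ v

lemma resolventKernel_Qminus_lt_top (h : IsLevyProcess μ coord) {B s : ℝ} (hB : 0 < B)
    (hs : 0 < s) (v : ℝ) : resolventKernel (Qminus μ coord B s) v Set.univ < ∞ := by
  rw [← Qplus_reflected h]
  exact resolventKernel_Qplus_lt_top (isLevyProcess_reflected h) hB hs v

lemma entryLaw_apply_le_one (h : IsLevyProcess μ coord) {s : ℝ} (hs : 0 ≤ s) (B y : ℝ) {u : Set ℝ}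
    (hu : MeasurableSet u) : entryLaw μ coord B s y u ≤ 1 := by
  rw [entryLaw_apply h B s y hu]
  calc _ ≤ ∫⁻ _, 1 ∂μ := lintegral_mono fun w =>
        mul_le_one' (disc_le_one hs _) (indicator_one_le _ _)
    _ = 1 := by rw [lintegral_one, measure_univ]

/-! ### Entry from outside the interval -/

/-- Entry from above: a passage over the interval and a passage back give one step of `Q₊`. -/
theorem entryLaw_above (h : IsLevyProcess μ coord) {B s v : ℝ} (hB : 0 < B) (hs : 0 < s)
    (hv : 0 ≤ v) (hexit : ∀ᵐ w ∂μ, exitTime coord B (v + B) w = 0) (hav : Avoids μ B (v + B))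
    {u : Set ℝ} (hum : MeasurableSet u) (hu : u ⊆ Set.Icc 0 B) :
    entryLaw μ coord B s (v + B) u =
      ∫⁻ l, downLaw μ coord s l {r | B - r ∈ u} ∂(resolventKernel (Qplus μ coord B s) v) +
      ∫⁻ l, (∫⁻ ν, upLaw μ coord s ν u ∂(downJumpLaw μ coord B s l))
        ∂(resolventKernel (Qplus μ coord B s) v) := by
  obtain ⟨ρ, hρ, hle⟩ := exists_Qplus_le h hB hs
  have hum' : MeasurableSet {r | B - r ∈ u} := (measurable_id.const_sub B) hum
  have hup : Measurable fun ν => upLaw μ coord s ν u :=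
    (Measure.measurable_coe hum).comp (measurable_upLaw s)
  have hg1 : Measurable fun l => downLaw μ coord s l {r | B - r ∈ u} :=
    (Measure.measurable_coe hum').comp (measurable_downLaw s)
  have hg2 : Measurable fun l => ∫⁻ ν, upLaw μ coord s ν u ∂(downJumpLaw μ coord B s l) :=
    (Measure.measurable_lintegral hup).comp (measurable_downJumpLaw B s)
  have hb : Measurable fun w => entryLaw μ coord B s (w + B) u :=
    (measurable_entryLaw_apply h B s hum).comp (measurable_id.add_const B)
  -- One renewal step: an entry equation from above, then one from below.
  have hstep : ∀ w, 0 ≤ w → (∀ᵐ p ∂μ, exitTime coord B (w + B) p = 0) → Avoids μ B (w + B) →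
      entryLaw μ coord B s (w + B) u =
        (downLaw μ coord s w {r | B - r ∈ u} +
          ∫⁻ ν, upLaw μ coord s ν u ∂(downJumpLaw μ coord B s w)) +
        ∫⁻ x, entryLaw μ coord B s (x + B) u ∂(Qplus μ coord B s w) := by
    intro w hw hex hw2
    have hocc : meanOcc μ w = 0 := by simpa using hw2.2
    rw [entryLaw_down h hB hw hex hocc hum hu, Qplus,
      Measure.lintegral_bind (measurable_upJumpLaw B s).aemeasurable hb.aemeasurable, add_assoc,
      ← lintegral_add_left hup]
    congr 1
    refine lintegral_congr_ae ((ae_avoids_down h s hw2).mono fun l hl => ?_)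
    exact entryLaw_up h hB hl.1 hl.2 hum hu
  have hGm : MeasurableSet {w | 0 < w ∧ Avoids μ B (w + B)} :=
    measurableSet_Ioi.inter ((measurable_id.add_const B) (measurableSet_avoids B))
  have hG : ∀ w, Avoids μ B (w + B) →
      ∀ᵐ x ∂(Qplus μ coord B s w), x ∈ {w | 0 < w ∧ Avoids μ B (w + B)} := by
    intro w hw
    change ((downJumpLaw μ coord B s w).bind (upJumpLaw μ coord B s))
      {w | 0 < w ∧ Avoids μ B (w + B)}ᶜ = 0
    rw [Measure.bind_apply hGm.compl (measurable_upJumpLaw B s).aemeasurable]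
    refine lintegral_eq_zero_of_ae_eq_zero ((ae_avoids_down h s hw).mono fun l hl => ?_)
    exact ae_iff.1 (ae_avoids_up h s hl.2)
  rw [← lintegral_add_left hg1]
  refine eq_lintegral_resolventKernel (b := fun w => entryLaw μ coord B s (w + B) u)
    (measurable_Qplus B s) hle hρ hb (hg1.add hg2)
    (fun w => entryLaw_apply_le_one h hs.le B _ hum) (fun w hw => ?_) (fun w hw => hG w hw.2) hGm
    (hstep v hv hexit hav) (hG v hav)
  refine hstep w hw.1.le (ae_of_all _ fun p => exitTime_eq_zero p fun hm => ?_) hw.2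
  have h1 := hm.2
  have h2 := hw.1
  linarith

/-- Entry from below, the reflection of `entryLaw_above`. -/
theorem entryLaw_below (h : IsLevyProcess μ coord) {B s v : ℝ} (hB : 0 < B) (hs : 0 < s)
    (hv : 0 ≤ v) (hexit : ∀ᵐ w ∂μ, exitTime coord B (-v) w = 0) (hav : Avoids μ B (-v))
    {u : Set ℝ} (hum : MeasurableSet u) (hu : u ⊆ Set.Icc 0 B) :
    entryLaw μ coord B s (-v) u =
      ∫⁻ l, upLaw μ coord s l u ∂(resolventKernel (Qminus μ coord B s) v) +
      ∫⁻ l, (∫⁻ ν, downLaw μ coord s ν {r | B - r ∈ u} ∂(upJumpLaw μ coord B s l))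
        ∂(resolventKernel (Qminus μ coord B s) v) := by
  have hum' : MeasurableSet {r | B - r ∈ u} := (measurable_id.const_sub B) hum
  have hinv : {r | B - r ∈ {r | B - r ∈ u}} = u := by ext r; simp
  have e : B - (v + B) = -v := by ring
  have hexit' : ∀ᵐ w ∂(reflected h), exitTime coord B (v + B) w = 0 := by
    refine ae_exitTime_eq_zero h.neg (hexit.mono fun w hw => ?_)
    rw [exitTime_neg, e, hw]
  have key := entryLaw_above (isLevyProcess_reflected h) hB hs hv hexit'
    ((avoids_reflected h B _).2 (by rwa [e])) hum' (fun r hr => mem_Icc_reflect.1 (hu hr))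
  simpa only [entryLaw_reflected h B s _ hum', downLaw_reflected, upLaw_reflected,
    downJumpLaw_reflected, Qplus_reflected, hinv, e] using key

end Mass

lemma upJumpLaw_eq {Ω : Type*} [MeasurableSpace Ω] {P : Measure Ω} {ξ : ℝ≥0 → Ω → ℝ}
    (h : IsLevyProcess P ξ) (B s : ℝ) :
    upJumpLaw P ξ B s = upJumpLaw (P.map (path h)) coord B s := by
  funext x
  rw [upJumpLaw, upJumpLaw, upLaw_eq h]

lemma downJumpLaw_eq {Ω : Type*} [MeasurableSpace Ω] {P : Measure Ω} {ξ : ℝ≥0 → Ω → ℝ}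
    (h : IsLevyProcess P ξ) (B s : ℝ) :
    downJumpLaw P ξ B s = downJumpLaw (P.map (path h)) coord B s := by
  funext x
  rw [downJumpLaw, downJumpLaw, downLaw_eq h]

lemma Qplus_eq {Ω : Type*} [MeasurableSpace Ω] {P : Measure Ω} {ξ : ℝ≥0 → Ω → ℝ}
    (h : IsLevyProcess P ξ) (B s : ℝ) :
    Qplus P ξ B s = Qplus (P.map (path h)) coord B s := by
  funext x
  rw [Qplus, Qplus, upJumpLaw_eq h, downJumpLaw_eq h]

lemma Qminus_eq {Ω : Type*} [MeasurableSpace Ω] {P : Measure Ω} {ξ : ℝ≥0 → Ω → ℝ}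
    (h : IsLevyProcess P ξ) (B s : ℝ) :
    Qminus P ξ B s = Qminus (P.map (path h)) coord B s := by
  funext x
  rw [Qminus, Qminus, upJumpLaw_eq h, downJumpLaw_eq h]

end LevyEntry

end

theorem theorem2 {Ω : Type*} [MeasurableSpace Ω] (P : Measure Ω) [IsProbabilityMeasure P]
    (ξ : ℝ≥0 → Ω → ℝ) (hξ : LevyEntry.IsLevyProcess P ξ)
    (B s : ℝ) (hB : 0 < B) (hs : 0 < s) :
    -- the position at the first entry lies in `[0,B]`
    (∀ (y : ℝ) (ω : Ω), LevyEntry.entryTime ξ B y ω < ∞ →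
      LevyEntry.entryPos ξ B y ω ∈ Set.Icc 0 B) ∧
    -- the series of iterated kernels converge
    (∀ v : ℝ, 0 ≤ v →
      LevyEntry.resolventKernel (LevyEntry.Qplus P ξ B s) v Set.univ < ∞ ∧
      LevyEntry.resolventKernel (LevyEntry.Qminus P ξ B s) v Set.univ < ∞) ∧
    -- start above the interval
    (∀ v : ℝ, (0 < v ∨ v = 0 ∧ ∀ᵐ ω ∂P, LevyEntry.exitTime ξ B B ω = 0) →
      LevyEntry.NoTimeAtEnds P ξ B (v + B) →
      ∀ u : Set ℝ, MeasurableSet u → u ⊆ Set.Icc 0 B →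
        LevyEntry.entryLaw P ξ B s (v + B) u =
          ∫⁻ l, LevyEntry.downLaw P ξ s l {r | B - r ∈ u}
              ∂(LevyEntry.resolventKernel (LevyEntry.Qplus P ξ B s) v) +
          ∫⁻ l, (∫⁻ ν, LevyEntry.upLaw P ξ s ν u ∂(LevyEntry.downJumpLaw P ξ B s l))
              ∂(LevyEntry.resolventKernel (LevyEntry.Qplus P ξ B s) v)) ∧
    -- start below the interval
    (∀ v : ℝ, (0 < v ∨ v = 0 ∧ ∀ᵐ ω ∂P, LevyEntry.exitTime ξ B 0 ω = 0) →
      LevyEntry.NoTimeAtEnds P ξ B (-v) →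
      ∀ u : Set ℝ, MeasurableSet u → u ⊆ Set.Icc 0 B →
        LevyEntry.entryLaw P ξ B s (-v) u =
          ∫⁻ l, LevyEntry.upLaw P ξ s l u
              ∂(LevyEntry.resolventKernel (LevyEntry.Qminus P ξ B s) v) +
          ∫⁻ l, (∫⁻ ν, LevyEntry.downLaw P ξ s ν {r | B - r ∈ u}
                ∂(LevyEntry.upJumpLaw P ξ B s l))
              ∂(LevyEntry.resolventKernel (LevyEntry.Qminus P ξ B s) v)) ∧
    -- start inside the interval
    (∀ y ∈ Set.Icc 0 B, ∀ u : Set ℝ, MeasurableSet u → u ⊆ Set.Icc 0 B →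
        LevyEntry.entryLaw P ξ B s y u =
          ∫⁻ v, LevyEntry.entryLaw P ξ B s (v + B) u ∂(LevyEntry.exitAboveLaw P ξ B s y) +
          ∫⁻ v, LevyEntry.entryLaw P ξ B s (-v) u ∂(LevyEntry.exitBelowLaw P ξ B s y)) := by
  have hμ := LevyEntry.isLevyProcess_map_path hξ
  have := LevyEntry.isProbabilityMeasure_map_path hξ
  rw [LevyEntry.upLaw_eq hξ, LevyEntry.downLaw_eq hξ, LevyEntry.entryLaw_eq hξ,
    LevyEntry.upJumpLaw_eq hξ, LevyEntry.downJumpLaw_eq hξ, LevyEntry.Qplus_eq hξ,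
    LevyEntry.Qminus_eq hξ]
  refine ⟨fun y ω h => LevyEntry.entryPos_mem (w := LevyEntry.path hξ ω) h,
    fun v _ => ⟨LevyEntry.resolventKernel_Qplus_lt_top hμ hB hs v,
      LevyEntry.resolventKernel_Qminus_lt_top hμ hB hs v⟩,
    fun v hv hz u hum hu => ?_, fun v hv hz u hum hu => ?_, fun y _ u hum _ => ?_⟩
  · have hv0 : 0 ≤ v := hv.elim le_of_lt fun h => h.1.ge
    refine LevyEntry.entryLaw_above hμ hB hs hv0 ?_ (LevyEntry.avoids_of_noTimeAtEnds hξ hz) hum hu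
    rcases hv with hv | ⟨rfl, he⟩
    · exact MeasureTheory.ae_of_all _ fun w => LevyEntry.exitTime_eq_zero w fun hm => by
        linarith [hm.2]
    · rw [zero_add]
      exact LevyEntry.ae_exitTime_eq_zero hξ he
  · have hv0 : 0 ≤ v := hv.elim le_of_lt fun h => h.1.ge
    refine LevyEntry.entryLaw_below hμ hB hs hv0 ?_ (LevyEntry.avoids_of_noTimeAtEnds hξ hz) hum hu
    rcases hv with hv | ⟨rfl, he⟩
    · exact MeasureTheory.ae_of_all _ fun w => LevyEntry.exitTime_eq_zero w fun hm => by
        linarith [hm.1]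
    · rw [neg_zero]
      exact LevyEntry.ae_exitTime_eq_zero hξ he
  · rw [LevyEntry.exitAboveLaw_eq hξ, LevyEntry.exitBelowLaw_eq hξ]
    exact LevyEntry.entryLaw_inside hμ hB s y hum
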